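/- Let $p>4$ and let $V:\mathbb R^2\to\mathbb R$ satisfy: (a) $V\in L^1_{\rm loc}(\mathbb R^2)$; (b) $\inf_{\mathbb R^2}V>0$; (c) $|\{x\in\mathbb R^2: V(x)\le M\}|<+\infty$ for every $M>0$. Let $$X:=\Big\{u\in H^1(\mathbb R^2)\ :\ \int_{\mathbb R^2}\log(1+|x|)\,u^2\,dx<\infty,\ \int_{\mathbb R^2}V(x)\,u^2\,dx<\infty\Big\}$$ be endowed with the Hilbert norm $$\|u\|_X^2:=\int_{\mathbb R^2}\big(|\nabla u|^2+V(x)u^2+\log(1+|x|)u^2\big)\,dx,$$ and define $I:X\to\mathbb R$ by $$I(u)=\frac12\int_{\mathbb R^2}\big(|\nabla u|^2+V(x)u^2\big)\,dx+\frac14\iint_{\mathbb R^2\times\mathbb R^2}\log(|x-y|)\,u^2(x)u^2(y)\,dx\,dy-\frac1p\int_{\mathbb R^2}|u|^p\,dx .$$ Let $c>0$ and let $\{u_n\}_n\subset X$ be a $(C)$ (Cerami) sequence for $I$ at the level $c$, that is, $I(u_n)\to c$ and $\|I'(u_n)\|_{X^*}\,(1+\|u_n\|_X)\to0$ as $n\to\infty$,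 where $I'$ is the Fréchet derivative of $I$. Then $\{u_n\}_n$ is bounded in $X$. Moreover, there exist $\bar x\in\mathbb R^2$ and a constant $d>0$ such that, up to a subsequence, $$\int_{B_2(\bar x)}u_n^2(x)\,dx\ge d\qquad\forall n\in\mathbb N,$$ where $B_2(\bar x)$ is the open ball of radius $2$ and center $\bar x$. -/

import Mathlib

noncomputable section

open MeasureTheory Filter Topology
open scoped ContDiff

namespace SchrodingerPoisson

/-- The Euclidean plane. -/
abbrev Plane : Type := EuclideanSpace ℝ (Fin 2)

/-- Real `L²(ℝ²)` and the vector-valued `L²(ℝ²; ℝ²)`, for Lebesgue measure. -/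
abbrev L2 : Type := Lp ℝ 2 (volume : Measure Plane)

abbrev L2Vec : Type := Lp Plane 2 (volume : Measure Plane)

/-- The standing assumptions on the potential: `V ∈ L¹_loc(ℝ²)`, `inf V > 0`, and all sublevel
sets `{V ≤ M}` have finite measure. -/
structure PotentialAssumption (V : Plane → ℝ) : Prop where
  locallyIntegrable : LocallyIntegrable V volume
  inf_pos : ∃ m : ℝ, 0 < m ∧ ∀ x, m ≤ V x
  sublevel_finite : ∀ M : ℝ, 0 < M → volume {x | V x ≤ M} < ⊤

/-- `g` is the weak gradient of `u`: `∫ u ∂ₑφ = -∫ (g · e) φ` for every test function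
`φ ∈ C_c^∞(ℝ²)` and every direction `e`. -/
def IsWeakGradient (u : L2) (g : L2Vec) : Prop :=
  ∀ φ : Plane → ℝ, ContDiff ℝ ∞ φ → HasCompactSupport φ → ∀ e : Plane,
    ∫ x, u x * fderiv ℝ φ x e = -∫ x, inner ℝ (g x) e * φ x

lemma integrable_mul_test {f : Plane → ℝ} (hf : MemLp f 2 volume) {ψ : Plane → ℝ}
    (hψ : Continuous ψ) (hc : HasCompactSupport ψ) :
    Integrable (fun x => f x * ψ x) volume :=
  hf.integrable_mul (hψ.memLp_of_hasCompactSupport (p := 2) hc)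

lemma integrable_test_left (u : L2) {φ : Plane → ℝ} (h : ContDiff ℝ ∞ φ)
    (hc : HasCompactSupport φ) (e : Plane) :
    Integrable (fun x => u x * fderiv ℝ φ x e) volume := by
  refine integrable_mul_test (Lp.memLp u) ?_ ?_
  · exact (h.continuous_fderiv (by simp)).clm_apply continuous_const
  · exact hc.fderiv_apply (𝕜 := ℝ) e

lemma integrable_test_right (g : L2Vec) {φ : Plane → ℝ} (h : ContDiff ℝ ∞ φ)
    (hc : HasCompactSupport φ) (e : Plane) :
    Integrable (fun x => inner ℝ (g x) e * φ x) volume :=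
  integrable_mul_test ((Lp.memLp g).inner_const e) h.continuous hc

lemma IsWeakGradient.add {u v : L2} {g k : L2Vec} (hu : IsWeakGradient u g)
    (hv : IsWeakGradient v k) : IsWeakGradient (u + v) (g + k) := by
  intro φ h hc e
  have e1 : ∫ x, (u + v : L2) x * fderiv ℝ φ x e
      = ∫ x, (u x * fderiv ℝ φ x e + v x * fderiv ℝ φ x e) := by
    refine integral_congr_ae ?_
    filter_upwards [Lp.coeFn_add u v] with x hx
    rw [hx, Pi.add_apply, add_mul]
  have e2 : ∫ x, inner ℝ ((g + k : L2Vec) x) e * φ x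
      = ∫ x, (inner ℝ (g x) e * φ x + inner ℝ (k x) e * φ x) := by
    refine integral_congr_ae ?_
    filter_upwards [Lp.coeFn_add g k] with x hx
    rw [hx, Pi.add_apply, inner_add_left, add_mul]
  rw [e1, e2, integral_add (integrable_test_left u h hc e) (integrable_test_left v h hc e),
    integral_add (integrable_test_right g h hc e) (integrable_test_right k h hc e),
    hu φ h hc e, hv φ h hc e]
  ring

lemma IsWeakGradient.smul {u : L2} {g : L2Vec} (hu : IsWeakGradient u g) (r : ℝ) :
    IsWeakGradient (r • u) (r • g) := by
  intro φ h hc e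
  have e1 : ∫ x, (r • u : L2) x * fderiv ℝ φ x e = ∫ x, r * (u x * fderiv ℝ φ x e) := by
    refine integral_congr_ae ?_
    filter_upwards [Lp.coeFn_smul r u] with x hx
    rw [hx, Pi.smul_apply, smul_eq_mul, mul_assoc]
  have e2 : ∫ x, inner ℝ ((r • g : L2Vec) x) e * φ x
      = ∫ x, r * (inner ℝ (g x) e * φ x) := by
    refine integral_congr_ae ?_
    filter_upwards [Lp.coeFn_smul r g] with x hx
    rw [hx, Pi.smul_apply, real_inner_smul_left, mul_assoc]
  rw [e1, e2, integral_const_mul, integral_const_mul, hu φ h hc e]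
  ring

lemma isWeakGradient_zero : IsWeakGradient 0 0 := by
  intro φ h hc e
  have e1 : ∫ x, (0 : L2) x * fderiv ℝ φ x e = ∫ _ : Plane, (0 : ℝ) := by
    refine integral_congr_ae ?_
    filter_upwards [Lp.coeFn_zero ℝ 2 (volume : Measure Plane)] with x hx
    rw [hx, Pi.zero_apply, zero_mul]
  have e2 : ∫ x, inner ℝ ((0 : L2Vec) x) e * φ x = ∫ _ : Plane, (0 : ℝ) := by
    refine integral_congr_ae ?_
    filter_upwards [Lp.coeFn_zero Plane 2 (volume : Measure Plane)] with x hx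
    rw [hx, Pi.zero_apply, inner_zero_left, zero_mul]
  rw [e1, e2]
  simp

/-- Weak gradients are unique. -/
lemma IsWeakGradient.unique {u : L2} {g k : L2Vec} (hg : IsWeakGradient u g)
    (hk : IsWeakGradient u k) : g = k := by
  have key : ∀ e : Plane, ∀ᵐ x, inner ℝ (g x) e - inner ℝ (k x) e = 0 := by
    intro e
    have hm : MemLp (fun x => inner ℝ (g x) e - inner ℝ (k x) e) 2 (volume : Measure Plane) :=
      ((Lp.memLp g).inner_const e).sub ((Lp.memLp k).inner_const e)
    refine ae_eq_zero_of_integral_contDiff_smul_eq_zero (hm.locallyIntegrable (by norm_num)) ?_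
    intro φ h hc
    have e1 : ∫ x, φ x • (inner ℝ (g x) e - inner ℝ (k x) e)
        = ∫ x, (inner ℝ (g x) e * φ x - inner ℝ (k x) e * φ x) := by
      congr 1
      funext x
      rw [smul_eq_mul]
      ring
    rw [e1, integral_sub (integrable_test_right g h hc e) (integrable_test_right k h hc e)]
    linarith [hg φ h hc e, hk φ h hc e]
  refine Lp.ext ?_
  have hall : ∀ᵐ x, ∀ i : Fin 2,
      inner ℝ (g x) (EuclideanSpace.single i (1 : ℝ))
        - inner ℝ (k x) (EuclideanSpace.single i (1 : ℝ)) = 0 :=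
    ae_all_iff.2 fun i => key _
  filter_upwards [hall] with x hx
  ext i
  have := hx i
  simp only [EuclideanSpace.inner_single_right] at this
  simpa [sub_eq_zero] using this

/-- The Sobolev space `H¹(ℝ²)`: the `L²` functions with a weak gradient in `L²`. -/
def H1 : Submodule ℝ L2 where
  carrier := {u | ∃ g : L2Vec, IsWeakGradient u g}
  add_mem' := fun ⟨g, hg⟩ ⟨k, hk⟩ => ⟨g + k, hg.add hk⟩
  zero_mem' := ⟨0, isWeakGradient_zero⟩
  smul_mem' := fun r _ ⟨g, hg⟩ => ⟨r • g, hg.smul r⟩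

/-- The weak gradient of an `H¹` function. -/
def H1.grad (u : H1) : L2Vec := Classical.choose u.2

lemma H1.grad_spec (u : H1) : IsWeakGradient (u : L2) (H1.grad u) := Classical.choose_spec u.2

lemma H1.grad_add (u v : H1) : H1.grad (u + v) = H1.grad u + H1.grad v :=
  (H1.grad_spec (u + v)).unique ((H1.grad_spec u).add (H1.grad_spec v))

lemma H1.grad_smul (r : ℝ) (u : H1) : H1.grad (r • u) = r • H1.grad u :=
  (H1.grad_spec (r • u)).unique ((H1.grad_spec u).smul r)

/-- The weight `log (1 + |x|)`. -/
def logWeight (x : Plane) : ℝ := Real.log (1 + ‖x‖)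

lemma logWeight_nonneg (x : Plane) : 0 ≤ logWeight x :=
  Real.log_nonneg (by linarith [norm_nonneg x])

lemma logWeight_continuous : Continuous logWeight := by
  unfold logWeight
  refine Continuous.log (by fun_prop) fun x => ?_
  have := norm_nonneg x
  positivity

/-- If `w u²` and `w v²` are integrable for a nonnegative weight `w`, so is `w u v`. -/
lemma integrable_weight_mul {w : Plane → ℝ} (hw : AEStronglyMeasurable w volume)
    (h0 : ∀ x, 0 ≤ w x) {u v : L2} (hu : Integrable (fun x => w x * u x ^ 2) volume)
    (hv : Integrable (fun x => w x * v x ^ 2) volume) :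
    Integrable (fun x => w x * (u x * v x)) volume := by
  refine (hu.add hv).mono' (hw.mul ((Lp.aestronglyMeasurable u).mul
    (Lp.aestronglyMeasurable v))) (Eventually.of_forall fun x => ?_)
  have h1 : |u x * v x| ≤ u x ^ 2 + v x ^ 2 := by
    rw [abs_le]
    constructor <;> nlinarith [sq_nonneg (u x + v x), sq_nonneg (u x - v x)]
  simp only [Pi.add_apply, Real.norm_eq_abs, abs_mul (w x), abs_of_nonneg (h0 x), ← mul_add]
  exact mul_le_mul_of_nonneg_left h1 (h0 x)

lemma integrable_weight_add {w : Plane → ℝ} (hw : AEStronglyMeasurable w volume)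
    (h0 : ∀ x, 0 ≤ w x) {u v : L2} (hu : Integrable (fun x => w x * u x ^ 2) volume)
    (hv : Integrable (fun x => w x * v x ^ 2) volume) :
    Integrable (fun x => w x * (u + v : L2) x ^ 2) volume := by
  refine ((hu.add hv).add ((integrable_weight_mul hw h0 hu hv).const_mul 2)).congr ?_
  filter_upwards [Lp.coeFn_add u v] with x hx
  simp only [hx, Pi.add_apply]
  ring

lemma integrable_weight_smul {w : Plane → ℝ} {u : L2} (r : ℝ)
    (hu : Integrable (fun x => w x * u x ^ 2) volume) :
    Integrable (fun x => w x * (r • u : L2) x ^ 2) volume := by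
  refine (hu.const_mul (r ^ 2)).congr ?_
  filter_upwards [Lp.coeFn_smul r u] with x hx
  simp only [hx, Pi.smul_apply, smul_eq_mul]
  ring

lemma integrable_weight_zero {w : Plane → ℝ} :
    Integrable (fun x => w x * (0 : L2) x ^ 2) volume := by
  refine (integrable_zero Plane ℝ volume).congr ?_
  filter_upwards [Lp.coeFn_zero ℝ 2 (volume : Measure Plane)] with x hx
  rw [hx, Pi.zero_apply, zero_pow two_ne_zero, mul_zero]

section Space

variable {V : Plane → ℝ}

lemma PotentialAssumption.pos (hV : PotentialAssumption V) (x : Plane) : 0 < V x := by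
  obtain ⟨m, hm, h⟩ := hV.inf_pos
  exact hm.trans_le (h x)

/-- The vector space underlying `X`: the `u ∈ H¹(ℝ²)` with `∫ log(1+|x|) u² < ∞` and
`∫ V u² < ∞`. -/
def XSubmodule (hV : PotentialAssumption V) : Submodule ℝ L2 where
  carrier := {u | u ∈ H1 ∧ Integrable (fun x => logWeight x * u x ^ 2) volume ∧
    Integrable (fun x => V x * u x ^ 2) volume}
  add_mem' := fun hu hv => ⟨H1.add_mem hu.1 hv.1,
    integrable_weight_add logWeight_continuous.aestronglyMeasurable logWeight_nonneg
      hu.2.1 hv.2.1,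
    integrable_weight_add hV.locallyIntegrable.aestronglyMeasurable (fun x => (hV.pos x).le)
      hu.2.2 hv.2.2⟩
  zero_mem' := ⟨H1.zero_mem, integrable_weight_zero, integrable_weight_zero⟩
  smul_mem' := fun r _ hu => ⟨H1.smul_mem r hu.1, integrable_weight_smul r hu.2.1,
    integrable_weight_smul r hu.2.2⟩

/-- The space `X`, a type synonym of `XSubmodule hV`, because it carries its own norm and not the
one of `L²`. -/
def X (hV : PotentialAssumption V) : Type := XSubmodule hV

variable {hV : PotentialAssumption V}

instance : AddCommGroup (X hV) := inferInstanceAs (AddCommGroup (XSubmodule hV))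

instance : Module ℝ (X hV) := inferInstanceAs (Module ℝ (XSubmodule hV))

/-- An element of `X` as an element of `H¹`. -/
def X.toH1 : X hV →ₗ[ℝ] H1 where
  toFun u := ⟨u.1, u.2.1⟩
  map_add' _ _ := rfl
  map_smul' _ _ := rfl

/-- An element of `X` as a function on the plane. -/
def X.fn (u : X hV) : Plane → ℝ := (u.1 : L2)

/-- The weak gradient of an element of `X`, as a vector field on the plane. -/
def X.grad (u : X hV) : Plane → Plane := H1.grad (X.toH1 u)

lemma X.fn_add (u v : X hV) : X.fn (u + v) =ᵐ[volume] X.fn u + X.fn v :=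
  Lp.coeFn_add (u.1 : L2) (v.1 : L2)

lemma X.fn_smul (r : ℝ) (u : X hV) : X.fn (r • u) =ᵐ[volume] r • X.fn u :=
  Lp.coeFn_smul r (u.1 : L2)

lemma X.grad_add (u v : X hV) : X.grad (u + v) =ᵐ[volume] X.grad u + X.grad v := by
  unfold X.grad
  rw [map_add, H1.grad_add]
  exact Lp.coeFn_add _ _

lemma X.grad_smul (r : ℝ) (u : X hV) : X.grad (r • u) =ᵐ[volume] r • X.grad u := by
  unfold X.grad
  rw [map_smul, H1.grad_smul]
  exact Lp.coeFn_smul _ _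

/-- The integrand `∇u · ∇v + V u v + log(1+|x|) u v` of the inner product of `X`. -/
def X.innerDensity (u v : X hV) (x : Plane) : ℝ :=
  inner ℝ (X.grad u x) (X.grad v x) + V x * (X.fn u x * X.fn v x)
    + logWeight x * (X.fn u x * X.fn v x)

lemma X.integrable_innerDensity (u v : X hV) : Integrable (X.innerDensity u v) volume :=
  ((L2.integrable_inner (𝕜 := ℝ) (H1.grad (X.toH1 u)) (H1.grad (X.toH1 v))).add
    (integrable_weight_mul hV.locallyIntegrable.aestronglyMeasurable (fun x => (hV.pos x).le)
      u.2.2.2 v.2.2.2)).add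
    (integrable_weight_mul logWeight_continuous.aestronglyMeasurable logWeight_nonneg
      u.2.2.1 v.2.2.1)

lemma X.innerDensity_self_nonneg (u : X hV) (x : Plane) : 0 ≤ X.innerDensity u u x := by
  unfold X.innerDensity
  have h1 : (0 : ℝ) ≤ inner ℝ (X.grad u x) (X.grad u x) := real_inner_self_nonneg
  have h2 := mul_nonneg (hV.pos x).le (mul_self_nonneg (X.fn u x))
  have h3 := mul_nonneg (logWeight_nonneg x) (mul_self_nonneg (X.fn u x))
  linarith

/-- The inner product `⟨u, v⟩ = ∫ (∇u · ∇v + V u v + log(1+|x|) u v) dx` on `X`. -/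
@[reducible] def X.core (hV : PotentialAssumption V) : InnerProductSpace.Core ℝ (X hV) where
  inner u v := ∫ x, X.innerDensity u v x
  conj_inner_symm u v := by
    simp only [conj_trivial]
    congr 1
    funext x
    simp only [X.innerDensity, real_inner_comm, mul_comm (X.fn u x)]
  re_inner_nonneg u := integral_nonneg (X.innerDensity_self_nonneg u)
  add_left u v w := by
    rw [← integral_add (X.integrable_innerDensity u w) (X.integrable_innerDensity v w)]
    refine integral_congr_ae ?_
    filter_upwards [X.fn_add u v, X.grad_add u v] with x h1 h2
    simp only [X.innerDensity, h1, h2, Pi.add_apply, inner_add_left]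
    ring
  smul_left u v r := by
    simp only [conj_trivial]
    rw [← integral_const_mul]
    refine integral_congr_ae ?_
    filter_upwards [X.fn_smul r u, X.grad_smul r u] with x h1 h2
    simp only [X.innerDensity, h1, h2, Pi.smul_apply, real_inner_smul_left, smul_eq_mul]
    ring
  definite u h := by
    have h0 := (integral_eq_zero_iff_of_nonneg (X.innerDensity_self_nonneg u)
      (X.integrable_innerDensity u u)).1 h
    refine Subtype.ext (Lp.ext ?_)
    filter_upwards [h0, Lp.coeFn_zero ℝ 2 (volume : Measure Plane)] with x hx hz
    refine Eq.trans ?_ hz.symm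
    change X.fn u x = 0
    simp only [X.innerDensity, Pi.zero_apply] at hx
    have h1 : (0 : ℝ) ≤ inner ℝ (X.grad u x) (X.grad u x) := real_inner_self_nonneg
    have h3 := mul_nonneg (logWeight_nonneg x) (mul_self_nonneg (X.fn u x))
    have h2 := mul_nonneg (hV.pos x).le (mul_self_nonneg (X.fn u x))
    have h4 : V x * (X.fn u x * X.fn u x) = 0 := by linarith
    rcases mul_eq_zero.1 h4 with h5 | h5
    · exact absurd h5 (hV.pos x).ne'
    · exact mul_self_eq_zero.1 h5

instance : NormedAddCommGroup (X hV) := (X.core hV).toNormedAddCommGroup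

instance : InnerProductSpace ℝ (X hV) := InnerProductSpace.ofCore (X.core hV).toCore

/-- The norm of `X` is `‖u‖² = ∫ (|∇u|² + V u² + log(1+|x|) u²) dx`. -/
lemma X.norm_sq (u : X hV) :
    ‖u‖ ^ 2 = ∫ x, (‖X.grad u x‖ ^ 2 + V x * X.fn u x ^ 2 + logWeight x * X.fn u x ^ 2) := by
  rw [← real_inner_self_eq_norm_sq]
  change ∫ x, X.innerDensity u u x = _
  simp only [X.innerDensity, real_inner_self_eq_norm_sq, sq (X.fn u _)]

end Space

/-- `B₁(f, g) = ∬ log(1 + |x - y|) f(x) g(y) dx dy`. -/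
def B₁ (f g : Plane → ℝ) : ℝ :=
  ∫ z : Plane × Plane, Real.log (1 + ‖z.1 - z.2‖) * f z.1 * g z.2

/-- `B₂(f, g) = ∬ log(1 + 1 / |x - y|) f(x) g(y) dx dy`. -/
def B₂ (f g : Plane → ℝ) : ℝ :=
  ∫ z : Plane × Plane, Real.log (1 + 1 / ‖z.1 - z.2‖) * f z.1 * g z.2

/-- `B₀ = B₁ - B₂`, the form with kernel `log |x - y|`, since
`log r = log(1 + r) - log(1 + 1 / r)` for `r > 0`. -/
def B₀ (f g : Plane → ℝ) : ℝ := B₁ f g - B₂ f g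

/-- `V₀(u) = B₀(u², u²)`. -/
def V₀ (u : Plane → ℝ) : ℝ := B₀ (fun x => u x ^ 2) (fun x => u x ^ 2)

/-- The action functional
`I(u) = 1/2 ∫ (|∇u|² + V u²) + 1/4 ∬ log|x-y| u²(x) u²(y) dx dy - 1/p ∫ |u|^p` on `X`. -/
def action {V : Plane → ℝ} (hV : PotentialAssumption V) (p : ℝ) (u : X hV) : ℝ :=
  (1 / 2) * (∫ x, (‖X.grad u x‖ ^ 2 + V x * X.fn u x ^ 2))
    + (1 / 4) * V₀ (X.fn u) - (1 / p) * (∫ x, |X.fn u x| ^ p)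

/-- Cerami sequences of a functional `J` at the level `c`: `J(xₙ) → c` and
`‖J'(xₙ)‖ (1 + ‖xₙ‖) → 0`, with the Fréchet derivative and the norm of the dual space. -/
def IsCeramiSeq {E : Type*} [NormedAddCommGroup E] [NormedSpace ℝ E] (J : E → ℝ) (c : ℝ)
    (x : ℕ → E) : Prop :=
  Tendsto (fun n => J (x n)) atTop (𝓝 c) ∧
    Tendsto (fun n => ‖fderiv ℝ J (x n)‖ * (1 + ‖x n‖)) atTop (𝓝 0)

end SchrodingerPoisson

end

noncomputable section

open MeasureTheory Filter Topology
open scoped ContDiff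

namespace SchrodingerPoisson

/-! Since `V₀` is homogeneous of degree 4, it cancels in `I(u) - I'(u)u/4`, which equals a quarter
of the energy `∫ (|∇u|² + V u²)` plus `(1/4 - 1/p) ∫ |u|ᵖ`. For `p > 4` both terms are nonnegative,
so a Cerami sequence has bounded energy (`IsCeramiSeq.exists_energy_le`). What remains to be
controlled is `∫ log(1+|x|) u²`.

Bounded energy and the finite measure of the sublevel sets of `V` give uniformly small `L²` tails
(`X.exists_setIntegral_compl_ball_le`). If the mass vanished on every ball of radius 2, the sequence
would therefore tend to 0 in `L²`, and by Gagliardo–Nirenberg in every `L^q` with `q ≥ 2`. Then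
`B₂(u², u²)` and `∫ |u|ᵖ` tend to 0, and `I'(u)u → 0` forces the energy plus `B₁(u², u²)` to 0,
whence `I → 0`, against `c > 0`. So some fixed ball keeps mass along a subsequence
(`IsCeramiSeq.exists_ball`).

The bound on `I'(u)u` also bounds `B₁(u², u²)`. For `y` in a fixed ball, `log(1+|x|) ≤ log(1+|x-y|)
+ const`, so mass on that ball turns the bound of `B₁` into one of the weighted norm
(`X.setIntegral_mul_weighted_le_B₁`). Applied along a subsequence whose norms tend to infinity, this
is a contradiction.

The supporting analysis is the planar Gagliardo–Nirenberg inequality for weak gradients, the bounds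
of the logarithmic forms, and the Fréchet differentiability of `I` on `X`, on which the formula for
`I'(u)u` rests. -/

/-! ### Gagliardo–Nirenberg inequalities for compactly supported functions -/

/-- The polynomial `t ↦ ∫ (t f + g)²` is nonnegative, so its discriminant is nonpositive. -/
lemma sq_integral_mul_le {α : Type*} [MeasurableSpace α] {μ : Measure α} {f g : α → ℝ}
    (hf : Integrable (fun x => f x ^ 2) μ) (hg : Integrable (fun x => g x ^ 2) μ)
    (hfg : Integrable (fun x => f x * g x) μ) :
    (∫ x, f x * g x ∂μ) ^ 2 ≤ (∫ x, f x ^ 2 ∂μ) * ∫ x, g x ^ 2 ∂μ := by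
  have key : ∀ t : ℝ, 0 ≤ (∫ x, f x ^ 2 ∂μ) * (t * t) + (2 * ∫ x, f x * g x ∂μ) * t
      + ∫ x, g x ^ 2 ∂μ := by
    intro t
    have h : 0 ≤ ∫ x, (f x * t + g x) ^ 2 ∂μ := integral_nonneg fun x => sq_nonneg _
    have e : ∫ x, (f x * t + g x) ^ 2 ∂μ
        = ∫ x, (t * t * f x ^ 2 + 2 * t * (f x * g x) + g x ^ 2) ∂μ := by
      congr 1; funext x; ring
    have i : Integrable (fun x => t * t * f x ^ 2 + 2 * t * (f x * g x)) μ :=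
      (hf.const_mul _).add (hfg.const_mul _)
    rw [e, integral_add i hg,
      integral_add (hf.const_mul _) (hfg.const_mul _), integral_const_mul,
      integral_const_mul] at h
    linarith
  have := discrim_le_zero key
  unfold discrim at this
  linarith

/-- The Gagliardo–Nirenberg–Sobolev inequality `‖w‖₂ ≤ C ‖∇w‖₁` in the plane. -/
lemma exists_integral_sq_le_sq_integral_fderiv : ∃ C : ℝ, 0 ≤ C ∧ ∀ w : Plane → ℝ, ContDiff ℝ 1 w →
    HasCompactSupport w → ∫ x, w x ^ 2 ≤ C * (∫ x, ‖fderiv ℝ w x‖) ^ 2 := by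
  -- The dimension 2 is its own Hölder conjugate, so an `L¹` gradient controls the `L²` norm.
  have hp : Real.HolderConjugate (Module.finrank ℝ Plane) 2 := by
    simpa using Real.HolderConjugate.two_two
  refine ⟨lintegralPowLePowLIntegralFDerivConst (volume : Measure Plane) 2, NNReal.coe_nonneg _,
    fun w hw hc => ?_⟩
  have h := lintegral_pow_le_pow_lintegral_fderiv (volume : Measure Plane) hw hc hp
  have hd : Integrable (fun x => ‖fderiv ℝ w x‖) (volume : Measure Plane) :=
    ((hw.continuous_fderiv one_ne_zero).integrable_of_hasCompactSupport (hc.fderiv ℝ)).norm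
  rw [integral_eq_lintegral_of_nonneg_ae (Eventually.of_forall fun x => sq_nonneg _)
    (hw.continuous.pow 2).aestronglyMeasurable,
    integral_eq_lintegral_of_nonneg_ae (Eventually.of_forall fun x => norm_nonneg _)
      hd.aestronglyMeasurable]
  have hfin : ∫⁻ x, ENNReal.ofReal ‖fderiv ℝ w x‖ ≠ ⊤ := by
    have := hd.2
    rw [hasFiniteIntegral_iff_ofReal (Eventually.of_forall fun x => norm_nonneg _)] at this
    exact this.ne
  have e1 : ∀ x, ENNReal.ofReal (w x ^ 2) = ‖w x‖ₑ ^ (2 : ℝ) := by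
    intro x
    rw [← sq_abs, ← Real.norm_eq_abs, ENNReal.ofReal_pow (norm_nonneg _), ofReal_norm]
    norm_cast
  simp only [e1, ofReal_norm] at hfin ⊢
  have := ENNReal.toReal_mono (ENNReal.mul_ne_top ENNReal.coe_ne_top
    (ENNReal.rpow_ne_top_of_nonneg (by norm_num) hfin)) h
  refine this.trans_eq ?_
  rw [ENNReal.toReal_mul, ← ENNReal.toReal_rpow]
  norm_cast

lemma hasCompactSupport_pow {f : Plane → ℝ} (hf : HasCompactSupport f) {n : ℕ} (hn : n ≠ 0) :
    HasCompactSupport (fun x => f x ^ n) :=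
  hf.comp_left (g := fun t : ℝ => t ^ n) (zero_pow hn)

/-- Induction on `k`: apply the `L¹`–`L²` inequality to `w ^ (k + 2)`, whose gradient has norm `(k +
2) |w|^(k+1) |∇w|`. Cauchy–Schwarz splits off one factor `∫ |∇w|²` and leaves `∫ w^(2(k+1))`, the
previous case. -/
lemma exists_integral_pow_le_of_hasCompactSupport (k : ℕ) : ∃ C : ℝ, 0 ≤ C ∧ ∀ w : Plane → ℝ,
    ContDiff ℝ 1 w → HasCompactSupport w →
    ∫ x, w x ^ (2 * (k + 1)) ≤ C * (∫ x, w x ^ 2) * (∫ x, ‖fderiv ℝ w x‖ ^ 2) ^ k := by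
  obtain ⟨K, hK, hGNS⟩ := exists_integral_sq_le_sq_integral_fderiv
  induction k with
  | zero => exact ⟨1, zero_le_one, fun w _ _ => by simp⟩
  | succ k ih =>
    obtain ⟨C, hC, ih⟩ := ih
    refine ⟨K * (k + 2) ^ 2 * C, by positivity, fun w hw hc => ?_⟩
    have hcd := hw.continuous_fderiv one_ne_zero
    have h1 := hGNS (fun x => w x ^ (k + 2)) (hw.pow _) (hasCompactSupport_pow hc (by omega))
    have hder : ∀ x, ‖fderiv ℝ (fun x => w x ^ (k + 2)) x‖
        = (k + 2) * (|w x| ^ (k + 1) * ‖fderiv ℝ w x‖) := by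
      intro x
      rw [fderiv_fun_pow (k + 2) (hw.differentiable one_ne_zero x), norm_smul]
      simp only [nsmul_eq_mul, norm_mul, norm_pow, Real.norm_eq_abs]
      have : |((k + 2 : ℕ) : ℝ)| = k + 2 := by rw [Nat.abs_cast]; push_cast; ring
      rw [this]
      simp [mul_assoc]
    simp only [hder] at h1
    rw [integral_const_mul] at h1
    have habs : HasCompactSupport (fun x => |w x| ^ (k + 1)) :=
      hc.comp_left (g := fun t : ℝ => |t| ^ (k + 1)) (by simp)
    have e1 : ∀ x, (|w x| ^ (k + 1)) ^ 2 = w x ^ (2 * (k + 1)) := fun x => by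
      rw [← pow_mul, mul_comm, pow_mul, sq_abs, ← pow_mul]
    have i1 : Integrable (fun x => (|w x| ^ (k + 1)) ^ 2) (volume : Measure Plane) := by
      simp only [e1]
      exact (hw.continuous.pow _).integrable_of_hasCompactSupport (hasCompactSupport_pow hc (by omega))
    have i2 : Integrable (fun x => ‖fderiv ℝ w x‖ ^ 2) (volume : Measure Plane) :=
      (hcd.norm.pow 2).integrable_of_hasCompactSupport
        (hasCompactSupport_pow (hc.fderiv ℝ).norm two_ne_zero)
    have i3 : Integrable (fun x => |w x| ^ (k + 1) * ‖fderiv ℝ w x‖) (volume : Measure Plane) :=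
      (Continuous.mul (hw.continuous.abs.pow _) hcd.norm).integrable_of_hasCompactSupport
        (HasCompactSupport.mul_right (f := fun x => |w x| ^ (k + 1)) habs)
    have h2 := sq_integral_mul_le i1 i2 i3
    have e2 : ∀ x, (w x ^ (k + 2)) ^ 2 = w x ^ (2 * (k + 1 + 1)) := fun x => by
      rw [← pow_mul]; ring_nf
    simp only [e1] at h2
    simp only [e2] at h1
    have h3 := ih w hw hc
    have hD : 0 ≤ ∫ x, ‖fderiv ℝ w x‖ ^ 2 := integral_nonneg fun x => by positivity
    calc ∫ x, w x ^ (2 * (k + 1 + 1))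
        ≤ K * ((k + 2) * ∫ x, |w x| ^ (k + 1) * ‖fderiv ℝ w x‖) ^ 2 := h1
      _ = K * (k + 2) ^ 2 * (∫ x, |w x| ^ (k + 1) * ‖fderiv ℝ w x‖) ^ 2 := by ring
      _ ≤ K * (k + 2) ^ 2 * ((∫ x, w x ^ (2 * (k + 1))) * ∫ x, ‖fderiv ℝ w x‖ ^ 2) := by gcongr
      _ ≤ K * (k + 2) ^ 2 * ((C * (∫ x, w x ^ 2) * (∫ x, ‖fderiv ℝ w x‖ ^ 2) ^ k)
            * ∫ x, ‖fderiv ℝ w x‖ ^ 2) := by gcongr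
      _ = _ := by ring

/-! ### Mollification of functions with a weak gradient -/

open ContinuousLinearMap in
/-- The mollification of `f` by the normalized bump function `φ`. -/
def mollify (φ : ContDiffBump (0 : Plane)) (f : Plane → ℝ) : Plane → ℝ :=
  convolution (φ.normed volume) f (lsmul ℝ ℝ) volume

section Mollify

variable (φ : ContDiffBump (0 : Plane))

lemma mollify_apply (f : Plane → ℝ) (x : Plane) :
    mollify φ f x = ∫ t, φ.normed volume (x - t) * f t := by
  unfold mollify
  rw [convolution_eq_swap]
  rfl

lemma contDiff_normed_sub (x : Plane) :
    ContDiff ℝ ∞ (fun t => φ.normed (volume : Measure Plane) (x - t)) :=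
  φ.contDiff_normed.comp (contDiff_const.sub contDiff_id)

lemma hasCompactSupport_normed_sub (x : Plane) :
    HasCompactSupport (fun t => φ.normed (volume : Measure Plane) (x - t)) :=
  φ.hasCompactSupport_normed.comp_homeomorph (Homeomorph.subLeft x)

lemma contDiff_mollify {f : Plane → ℝ} (hf : MemLp f 2 volume) : ContDiff ℝ ∞ (mollify φ f) :=
  φ.hasCompactSupport_normed.contDiff_convolution_left _ φ.contDiff_normed
    (hf.locallyIntegrable (by norm_num))

/-- Jensen's inequality for a probability density `ρ`, obtained from Cauchy–Schwarz for `√ρ` and `√ρ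
f`. -/
lemma sq_mollify_le {f : Plane → ℝ} (hf : MemLp f 2 volume) (x : Plane) :
    mollify φ f x ^ 2 ≤ mollify φ (fun t => f t ^ 2) x := by
  have h0 : ∀ t, 0 ≤ φ.normed (volume : Measure Plane) (x - t) := fun t => φ.nonneg_normed _
  have hsq := fun t => Real.mul_self_sqrt (h0 t)
  have hcont := (contDiff_normed_sub φ x).continuous
  have e1 : ∀ t, √(φ.normed (volume : Measure Plane) (x - t)) ^ 2
      = φ.normed volume (x - t) := fun t => Real.sq_sqrt (h0 t)
  have e2 : ∀ t, (√(φ.normed (volume : Measure Plane) (x - t)) * f t) ^ 2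
      = φ.normed volume (x - t) * f t ^ 2 := fun t => by rw [mul_pow, e1]
  have e3 : ∀ t, √(φ.normed (volume : Measure Plane) (x - t))
      * (√(φ.normed (volume : Measure Plane) (x - t)) * f t)
      = φ.normed volume (x - t) * f t := fun t => by rw [← mul_assoc, hsq]
  have i1 : Integrable (fun t => φ.normed (volume : Measure Plane) (x - t)) volume :=
    hcont.integrable_of_hasCompactSupport (hasCompactSupport_normed_sub φ x)
  have i2 : Integrable (fun t => φ.normed (volume : Measure Plane) (x - t) * f t ^ 2) volume := by
    obtain ⟨K, hK⟩ := hcont.bounded_above_of_compact_support (hasCompactSupport_normed_sub φ x)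
    exact hf.integrable_sq.bdd_mul hcont.aestronglyMeasurable (Eventually.of_forall hK)
  have i3 : Integrable (fun t => φ.normed (volume : Measure Plane) (x - t) * f t) volume := by
    simpa only [mul_comm] using integrable_mul_test hf hcont (hasCompactSupport_normed_sub φ x)
  have h := sq_integral_mul_le (μ := volume)
    (f := fun t => √(φ.normed (volume : Measure Plane) (x - t)))
    (g := fun t => √(φ.normed (volume : Measure Plane) (x - t)) * f t)
    (by simpa only [e1] using i1) (by simpa only [e2] using i2) (by simpa only [e3] using i3)
  simp only [e1, e2, e3] at h
  rw [integral_sub_left_eq_self (fun t => φ.normed (volume : Measure Plane) t) volume x,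
    φ.integral_normed, one_mul] at h
  rwa [mollify_apply, mollify_apply]

lemma integrable_sq_mollify {f : Plane → ℝ} (hf : MemLp f 2 volume) :
    Integrable (fun x => mollify φ f x ^ 2) volume := by
  have i : Integrable (mollify φ (fun t => f t ^ 2)) volume :=
    φ.integrable_normed.integrable_convolution _ hf.integrable_sq
  refine i.mono' ((contDiff_mollify φ hf).continuous.pow 2).aestronglyMeasurable
    (Eventually.of_forall fun x => ?_)
  rw [Real.norm_of_nonneg (sq_nonneg _)]
  exact sq_mollify_le φ hf x

lemma integral_sq_mollify_le {f : Plane → ℝ} (hf : MemLp f 2 volume) :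
    ∫ x, mollify φ f x ^ 2 ≤ ∫ x, f x ^ 2 := by
  have i : Integrable (mollify φ (fun t => f t ^ 2)) volume :=
    φ.integrable_normed.integrable_convolution _ hf.integrable_sq
  refine (integral_mono (integrable_sq_mollify φ hf) i (sq_mollify_le φ hf)).trans_eq ?_
  unfold mollify
  rw [integral_convolution _ φ.integrable_normed hf.integrable_sq, φ.integral_normed]
  simp

/-- The derivative falls on the kernel, and `t ↦ ρ(x - t)` is an admissible test function for the
weak gradient. The sign from its inner derivative cancels the sign of the integration by parts. -/
lemma fderiv_mollify_apply {u : L2} {g : L2Vec} (hg : IsWeakGradient u g) (x e : Plane) :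
    fderiv ℝ (mollify φ u) x e = ∫ t, φ.normed volume (x - t) * inner ℝ (g t) e := by
  have hu : LocallyIntegrable u (volume : Measure Plane) :=
    (Lp.memLp u).locallyIntegrable (by norm_num)
  have hc : HasCompactSupport (φ.normed (volume : Measure Plane)) := φ.hasCompactSupport_normed
  have hs : ContDiff ℝ 1 (φ.normed (volume : Measure Plane)) := φ.contDiff_normed
  have h := hc.hasFDerivAt_convolution_left (ContinuousLinearMap.lsmul ℝ ℝ) hs hu x
  have hex : ConvolutionExistsAt (fderiv ℝ (φ.normed (volume : Measure Plane))) u x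
      ((ContinuousLinearMap.lsmul ℝ ℝ).precompL Plane) volume :=
    (hc.fderiv ℝ).convolutionExists_left _ (hs.continuous_fderiv one_ne_zero) hu x
  have e1 : fderiv ℝ (mollify φ u) x e
      = ∫ t, fderiv ℝ (φ.normed (volume : Measure Plane)) (x - t) e * u t := by
    unfold mollify
    rw [h.fderiv, convolution_eq_swap, ContinuousLinearMap.integral_apply]
    · rfl
    · exact hex.integrable_swap
  have hψ : ∀ t, fderiv ℝ (fun t => φ.normed (volume : Measure Plane) (x - t)) t e
      = -fderiv ℝ (φ.normed (volume : Measure Plane)) (x - t) e := by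
    intro t
    have hd := (hs.differentiable one_ne_zero (x - t)).hasFDerivAt.comp t
      ((hasFDerivAt_id (𝕜 := ℝ) t).const_sub x)
    have := hd.fderiv
    simp only [Function.comp_def] at this
    rw [this]
    simp
  have h2 := hg _ (contDiff_normed_sub φ x) (hasCompactSupport_normed_sub φ x) e
  simp only [hψ, mul_neg, integral_neg, neg_inj] at h2
  rw [e1]
  simpa only [mul_comm] using h2

/-- The bound is by a mollified scalar function, so the `L²` contraction for scalar mollification
applies to the gradient as well. -/
lemma norm_fderiv_mollify_le {u : L2} {g : L2Vec} (hg : IsWeakGradient u g) (x : Plane) :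
    ‖fderiv ℝ (mollify φ u) x‖ ≤ mollify φ (fun t => ‖g t‖) x := by
  have h0 : ∀ t, 0 ≤ φ.normed (volume : Measure Plane) (x - t) := fun t => φ.nonneg_normed _
  have i : Integrable (fun t => φ.normed (volume : Measure Plane) (x - t) * ‖g t‖) volume := by
    simpa only [mul_comm] using integrable_mul_test (Lp.memLp g).norm
      (contDiff_normed_sub φ x).continuous (hasCompactSupport_normed_sub φ x)
  rw [mollify_apply]
  refine ContinuousLinearMap.opNorm_le_bound _
    (integral_nonneg fun t => mul_nonneg (h0 t) (norm_nonneg _)) fun e => ?_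
  rw [fderiv_mollify_apply φ hg, ← integral_mul_const]
  refine norm_integral_le_of_norm_le (i.mul_const _) (Eventually.of_forall fun t => ?_)
  rw [norm_mul, Real.norm_of_nonneg (h0 t), mul_assoc]
  exact mul_le_mul_of_nonneg_left (norm_inner_le_norm _ _) (h0 t)

end Mollify

/-! ### Cutoffs and Gagliardo–Nirenberg for weak gradients -/

/-- The standard cutoff at scale `n + 1`. -/
def cutoff (n : ℕ) (x : Plane) : ℝ :=
  (⟨1, 2, one_pos, one_lt_two⟩ : ContDiffBump (0 : Plane)) ((n + 1 : ℝ)⁻¹ • x)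

lemma contDiff_cutoff (n : ℕ) : ContDiff ℝ ∞ (cutoff n) :=
  (ContDiffBump.contDiff _).comp (contDiff_id.const_smul _)

lemma hasCompactSupport_cutoff (n : ℕ) : HasCompactSupport (cutoff n) :=
  (ContDiffBump.hasCompactSupport _).comp_homeomorph
    (Homeomorph.smulOfNeZero ((n + 1 : ℝ)⁻¹) (by positivity))

lemma cutoff_nonneg (n : ℕ) (x : Plane) : 0 ≤ cutoff n x := ContDiffBump.nonneg _

lemma cutoff_le_one (n : ℕ) (x : Plane) : cutoff n x ≤ 1 := ContDiffBump.le_one _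

lemma eventually_cutoff_eq_one (x : Plane) : ∀ᶠ n : ℕ in atTop, cutoff n x = 1 := by
  obtain ⟨N, hN⟩ := exists_nat_ge ‖x‖
  filter_upwards [eventually_ge_atTop N] with n hn
  refine ContDiffBump.one_of_mem_closedBall _ ?_
  rw [mem_closedBall_zero_iff, norm_smul, norm_inv, Real.norm_of_nonneg (by positivity),
    inv_mul_le_iff₀ (by positivity)]
  have : (N : ℝ) ≤ n := by exact_mod_cast hn
  simp only [mul_one]
  linarith

/-- Rescaling multiplies the derivative by `(n + 1)⁻¹ ≤ 1`. A uniform bound is enough, at the price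
of a term `∫ u²` beside `∫ |g|²` in the resulting inequality. -/
lemma exists_norm_fderiv_cutoff_le : ∃ K : ℝ, 0 ≤ K ∧ ∀ n x, ‖fderiv ℝ (cutoff n) x‖ ≤ K := by
  set χ : ContDiffBump (0 : Plane) := ⟨1, 2, one_pos, one_lt_two⟩ with hχ
  have hs : ContDiff ℝ 1 χ := χ.contDiff
  obtain ⟨K, hK⟩ := (hs.continuous_fderiv one_ne_zero).bounded_above_of_compact_support
    (χ.hasCompactSupport.fderiv ℝ)
  have hK0 : 0 ≤ K := (norm_nonneg _).trans (hK 0)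
  refine ⟨K, hK0, fun n x => ?_⟩
  have : cutoff n = fun x => χ ((n + 1 : ℝ)⁻¹ • x) := rfl
  rw [this, fderiv_comp_smul, norm_smul, norm_inv, Real.norm_of_nonneg (by positivity)]
  have h1 : ((n : ℝ) + 1)⁻¹ ≤ 1 := inv_le_one_of_one_le₀ (by linarith [n.cast_nonneg (α := ℝ)])
  calc ((n : ℝ) + 1)⁻¹ * ‖fderiv ℝ χ ((n + 1 : ℝ)⁻¹ • x)‖ ≤ 1 * K :=
        mul_le_mul h1 (hK _) (norm_nonneg _) zero_le_one
    _ = K := one_mul K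

/-- The Gagliardo–Nirenberg inequality in even exponents for functions with a weak gradient
in `L²`. -/
theorem exists_integral_pow_le_of_isWeakGradient (k : ℕ) : ∃ C : ℝ, 0 ≤ C ∧
    ∀ (u : L2) (g : L2Vec), IsWeakGradient u g →
      Integrable (fun x => u x ^ (2 * (k + 1))) volume ∧
      ∫ x, u x ^ (2 * (k + 1)) ≤
        C * (∫ x, u x ^ 2) * ((∫ x, u x ^ 2) + ∫ x, ‖g x‖ ^ 2) ^ k := by
  obtain ⟨C, hC, hS⟩ := exists_integral_pow_le_of_hasCompactSupport k
  obtain ⟨K, hK, hχ⟩ := exists_norm_fderiv_cutoff_le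
  refine ⟨C * (2 + 2 * K ^ 2) ^ k, by positivity, fun u g hg => ?_⟩
  have hu := Lp.memLp u
  have hgn := (Lp.memLp g).norm
  -- The ratio of outer to inner radius stays equal to 2, as the almost everywhere convergence of
  -- the mollifications demands (`K := 2` below).
  let φ : ℕ → ContDiffBump (0 : Plane) := fun n =>
    ⟨((n : ℝ) + 1)⁻¹, 2 * ((n : ℝ) + 1)⁻¹, by positivity, by
      have : 0 < ((n : ℝ) + 1)⁻¹ := by positivity
      linarith⟩
  have hφ : Tendsto (fun n => (φ n).rOut) atTop (𝓝 0) := by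
    have := (tendsto_one_div_add_atTop_nhds_zero_nat (𝕜 := ℝ)).const_mul 2
    simpa [φ] using this
  have hae : ∀ᵐ x, Tendsto (fun n => mollify (φ n) u x) atTop (𝓝 (u x)) :=
    ContDiffBump.ae_convolution_tendsto_right_of_locallyIntegrable (K := 2) hφ
      (Eventually.of_forall fun n => le_rfl) (hu.locallyIntegrable (by norm_num))
  set w : ℕ → Plane → ℝ := fun n x => cutoff n x * mollify (φ n) u x with hw
  have hwC : ∀ n, ContDiff ℝ 1 (w n) := fun n =>
    ((contDiff_cutoff n).mul (contDiff_mollify (φ n) hu)).of_le (by simp)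
  have hwc : ∀ n, HasCompactSupport (w n) := fun n =>
    HasCompactSupport.mul_right (f := cutoff n) (hasCompactSupport_cutoff n)
  have hwae : ∀ᵐ x, Tendsto (fun n => w n x) atTop (𝓝 (u x)) := by
    filter_upwards [hae] with x hx
    refine hx.congr' ?_
    filter_upwards [eventually_cutoff_eq_one x] with n hn
    simp only [hw, hn, one_mul]
  set A := ∫ x, u x ^ 2
  set D := ∫ x, ‖g x‖ ^ 2
  have hA : 0 ≤ A := integral_nonneg fun x => sq_nonneg _
  have hD : 0 ≤ D := integral_nonneg fun x => by positivity
  have hw2 : ∀ n, ∫ x, w n x ^ 2 ≤ A := by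
    intro n
    refine le_trans ?_ (integral_sq_mollify_le (φ n) hu)
    refine integral_mono ?_ (integrable_sq_mollify (φ n) hu) fun x => ?_
    · exact ((hwC n).continuous.pow 2).integrable_of_hasCompactSupport
        (hasCompactSupport_pow (hwc n) two_ne_zero)
    · simp only [hw, mul_pow]
      exact mul_le_of_le_one_left (sq_nonneg _)
        (pow_le_one₀ (cutoff_nonneg n x) (cutoff_le_one n x))
  -- The product rule gives `|∇w| ≤ ρ∗|g| + K |ρ∗u|`; then `(a + b)² ≤ 2a² + 2b²` and the `L²`
  -- contraction.
  have hwd : ∀ n, ∫ x, ‖fderiv ℝ (w n) x‖ ^ 2 ≤ (2 + 2 * K ^ 2) * (A + D) := by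
    intro n
    have i1 := (integrable_sq_mollify (φ n) hgn).const_mul 2
    have i2 := (integrable_sq_mollify (φ n) hu).const_mul (2 * K ^ 2)
    have hpt : ∀ x, ‖fderiv ℝ (w n) x‖ ^ 2 ≤ 2 * mollify (φ n) (fun t => ‖g t‖) x ^ 2
        + 2 * K ^ 2 * mollify (φ n) u x ^ 2 := by
      intro x
      have hd1 : DifferentiableAt ℝ (cutoff n) x :=
        (contDiff_cutoff n).contDiffAt.differentiableAt (by simp)
      have hd2 : DifferentiableAt ℝ (mollify (φ n) u) x :=
        (contDiff_mollify (φ n) hu).contDiffAt.differentiableAt (by simp)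
      have h1 : ‖fderiv ℝ (w n) x‖ ≤ mollify (φ n) (fun t => ‖g t‖) x
          + K * |mollify (φ n) u x| := by
        rw [hw, fderiv_fun_mul hd1 hd2]
        refine (norm_add_le _ _).trans ?_
        rw [norm_smul, norm_smul, Real.norm_of_nonneg (cutoff_nonneg n x), Real.norm_eq_abs,
          mul_comm K]
        refine add_le_add ?_ (mul_le_mul_of_nonneg_left (hχ n x) (abs_nonneg _))
        exact (mul_le_of_le_one_left (norm_nonneg _) (cutoff_le_one n x)).trans
          (norm_fderiv_mollify_le (φ n) hg x)
      have h2 := pow_le_pow_left₀ (norm_nonneg _) h1 2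
      have h3 := sq_abs (mollify (φ n) u x)
      nlinarith [sq_nonneg (mollify (φ n) (fun t => ‖g t‖) x - K * |mollify (φ n) u x|)]
    have hi : Integrable (fun x => ‖fderiv ℝ (w n) x‖ ^ 2) volume :=
      (((hwC n).continuous_fderiv one_ne_zero).norm.pow 2).integrable_of_hasCompactSupport
        (hasCompactSupport_pow ((hwc n).fderiv ℝ).norm two_ne_zero)
    have h := integral_mono hi (i1.add i2) hpt
    simp only [Pi.add_apply] at h
    rw [integral_add i1 i2, integral_const_mul, integral_const_mul] at h
    have h1 := integral_sq_mollify_le (φ n) hgn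
    have h2 := integral_sq_mollify_le (φ n) hu
    have h3 : 2 * K ^ 2 * ∫ x, mollify (φ n) u x ^ 2 ≤ 2 * K ^ 2 * A := by gcongr
    have h4 : 0 ≤ K ^ 2 * D := by positivity
    nlinarith
  have hb : ∀ n, ∫ x, w n x ^ (2 * (k + 1)) ≤ C * (2 + 2 * K ^ 2) ^ k * A * (A + D) ^ k := by
    intro n
    refine (hS (w n) (hwC n) (hwc n)).trans ?_
    have h0 : 0 ≤ ∫ x, ‖fderiv ℝ (w n) x‖ ^ 2 := integral_nonneg fun x => by positivity
    calc C * (∫ x, w n x ^ 2) * (∫ x, ‖fderiv ℝ (w n) x‖ ^ 2) ^ k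
        ≤ C * A * ((2 + 2 * K ^ 2) * (A + D)) ^ k := by
          gcongr
          · exact hw2 n
          · exact hwd n
      _ = _ := by rw [mul_pow]; ring
  have heven : Even (2 * (k + 1)) := even_two_mul _
  have hlim : ∀ᵐ x, Tendsto (fun n => ENNReal.ofReal (w n x ^ (2 * (k + 1)))) atTop
      (𝓝 (ENNReal.ofReal (u x ^ (2 * (k + 1))))) := by
    filter_upwards [hwae] with x hx
    exact ENNReal.tendsto_ofReal (hx.pow _)
  -- Fatou's lemma needs only almost everywhere convergence, and yields integrability and the bound
  -- at once.
  have hfatou : ∫⁻ x, ENNReal.ofReal (u x ^ (2 * (k + 1)))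
      ≤ ENNReal.ofReal (C * (2 + 2 * K ^ 2) ^ k * A * (A + D) ^ k) := by
    calc ∫⁻ x, ENNReal.ofReal (u x ^ (2 * (k + 1)))
        = ∫⁻ x, liminf (fun n => ENNReal.ofReal (w n x ^ (2 * (k + 1)))) atTop := by
          refine lintegral_congr_ae ?_
          filter_upwards [hlim] with x hx
          exact hx.liminf_eq.symm
      _ ≤ liminf (fun n => ∫⁻ x, ENNReal.ofReal (w n x ^ (2 * (k + 1)))) atTop :=
          lintegral_liminf_le fun n => ((hwC n).continuous.pow _).measurable.ennreal_ofReal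
      _ ≤ liminf (fun _ : ℕ => ENNReal.ofReal (C * (2 + 2 * K ^ 2) ^ k * A * (A + D) ^ k))
            atTop := by
          refine liminf_le_liminf (Eventually.of_forall fun n => ?_)
          have hi : Integrable (fun x => w n x ^ (2 * (k + 1))) volume :=
            ((hwC n).continuous.pow _).integrable_of_hasCompactSupport
              (hasCompactSupport_pow (hwc n) (by omega))
          rw [← ofReal_integral_eq_lintegral_ofReal hi
            (Eventually.of_forall fun x => heven.pow_nonneg _)]
          exact ENNReal.ofReal_le_ofReal (hb n)
      _ = _ := liminf_const _
  have hmeas : AEStronglyMeasurable (fun x => u x ^ (2 * (k + 1))) (volume : Measure Plane) :=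
    (Lp.aestronglyMeasurable u).pow _
  refine ⟨⟨hmeas, ?_⟩, ?_⟩
  · rw [hasFiniteIntegral_iff_ofReal (Eventually.of_forall fun x => heven.pow_nonneg _)]
    exact hfatou.trans_lt ENNReal.ofReal_lt_top
  · rw [integral_eq_lintegral_of_nonneg_ae (Eventually.of_forall fun x => heven.pow_nonneg _) hmeas]
    exact ENNReal.toReal_le_of_le_ofReal (by positivity) hfatou

/-! ### Bounds of the logarithmic bilinear forms -/

/-- The functions on which the logarithmic forms are bounded. -/
structure LogIntegrable (f : Plane → ℝ) : Prop where
  integrable : Integrable f volume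
  weighted : Integrable (fun x => logWeight x * f x) volume
  sq : Integrable (fun x => f x ^ 2) volume

/-- The size of `f` that controls the logarithmic forms. -/
def logSize (f : Plane → ℝ) : ℝ :=
  (∫ x, |f x|) + (∫ x, logWeight x * |f x|) + √(∫ x, f x ^ 2)

lemma integral_abs_nonneg (f : Plane → ℝ) : 0 ≤ ∫ x, |f x| := integral_nonneg fun _ => abs_nonneg _

lemma integral_logWeight_abs_nonneg (f : Plane → ℝ) : 0 ≤ ∫ x, logWeight x * |f x| :=
  integral_nonneg fun x => mul_nonneg (logWeight_nonneg x) (abs_nonneg _)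

lemma logSize_nonneg (f : Plane → ℝ) : 0 ≤ logSize f :=
  add_nonneg (add_nonneg (integral_abs_nonneg f) (integral_logWeight_abs_nonneg f))
    (Real.sqrt_nonneg _)

lemma LogIntegrable.weighted_abs {f : Plane → ℝ} (hf : LogIntegrable f) :
    Integrable (fun x => logWeight x * |f x|) volume := by
  refine hf.weighted.abs.congr (Eventually.of_forall fun x => ?_)
  simp only [abs_mul, abs_of_nonneg (logWeight_nonneg x)]

lemma LogIntegrable.add {f g : Plane → ℝ} (hf : LogIntegrable f) (hg : LogIntegrable g) :
    LogIntegrable (fun x => f x + g x) where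
  integrable := hf.integrable.add hg.integrable
  weighted := by
    simp only [mul_add]
    exact hf.weighted.add hg.weighted
  sq := by
    have h1 : MemLp f 2 volume := (memLp_two_iff_integrable_sq hf.integrable.1).2 hf.sq
    have h2 : MemLp g 2 volume := (memLp_two_iff_integrable_sq hg.integrable.1).2 hg.sq
    exact (h1.add h2).integrable_sq

lemma LogIntegrable.const_mul {f : Plane → ℝ} (hf : LogIntegrable f) (r : ℝ) :
    LogIntegrable (fun x => r * f x) where
  integrable := hf.integrable.const_mul r
  weighted := by simpa only [mul_left_comm] using hf.weighted.const_mul r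
  sq := by simpa only [mul_pow] using hf.sq.const_mul (r ^ 2)

/-- The bilinear form `∬ k(x - y) f(x) g(y) dx dy`. -/
def kernelForm (k : Plane → ℝ) (f g : Plane → ℝ) : ℝ :=
  ∫ z : Plane × Plane, k (z.1 - z.2) * f z.1 * g z.2

section KernelForm

variable {k f f' g g' : Plane → ℝ}

lemma kernelForm_congr (hf : f =ᵐ[volume] f') (hg : g =ᵐ[volume] g') :
    kernelForm k f g = kernelForm k f' g' := by
  refine integral_congr_ae ?_
  have h1 : ∀ᵐ z : Plane × Plane, f z.1 = f' z.1 :=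
    (Measure.quasiMeasurePreserving_fst (μ := volume) (ν := volume)).ae hf
  have h2 : ∀ᵐ z : Plane × Plane, g z.2 = g' z.2 :=
    (Measure.quasiMeasurePreserving_snd (μ := volume) (ν := volume)).ae hg
  filter_upwards [h1, h2] with z e1 e2
  simp only [e1, e2]

lemma kernelForm_symm (hk : ∀ x, k (-x) = k x) : kernelForm k f g = kernelForm k g f := by
  unfold kernelForm
  -- The volume on the product is by definition the product measure; `integral_prod_swap` needs that
  -- form.
  change ∫ z, _ ∂((volume : Measure Plane).prod volume)
    = ∫ z, _ ∂((volume : Measure Plane).prod volume)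
  rw [← integral_prod_swap]
  congr 1
  funext z
  simp only [Prod.fst_swap, Prod.snd_swap]
  rw [← neg_sub z.1 z.2, hk]
  ring

lemma kernelForm_const_mul_left (r : ℝ) :
    kernelForm k (fun x => r * f x) g = r * kernelForm k f g := by
  unfold kernelForm
  rw [← integral_const_mul]
  congr 1
  funext z
  ring

lemma kernelForm_add_left
    (h : Integrable (fun z : Plane × Plane => k (z.1 - z.2) * f z.1 * g z.2) volume)
    (h' : Integrable (fun z : Plane × Plane => k (z.1 - z.2) * f' z.1 * g z.2) volume) :
    kernelForm k (fun x => f x + f' x) g = kernelForm k f g + kernelForm k f' g := by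
  unfold kernelForm
  rw [← integral_add h h']
  congr 1
  funext z
  ring

lemma integrable_kernel_mul_snd (hk : Integrable k volume) (hf : Integrable f volume) :
    Integrable (fun z : Plane × Plane => k (z.1 - z.2) * f z.2) volume := by
  simp only [mul_comm (k _)]
  exact hf.convolution_integrand (ContinuousLinearMap.mul ℝ ℝ) hk

/-- Fubini, integrating first in the variable that `f` does not see, and translation invariance. -/
lemma integral_kernel_mul_snd (hk : Integrable k volume) (hf : Integrable f volume) :
    ∫ z : Plane × Plane, k (z.1 - z.2) * f z.2 = (∫ x, k x) * ∫ x, f x := by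
  have h := integrable_kernel_mul_snd hk hf
  change Integrable _ ((volume : Measure Plane).prod volume) at h
  change ∫ z, _ ∂((volume : Measure Plane).prod volume) = _
  rw [integral_prod_symm _ h]
  simp only [integral_mul_const]
  simp_rw [integral_sub_right_eq_self k]
  rw [integral_const_mul]

lemma integrable_kernel_mul_fst (hk : Integrable k volume) (hs : ∀ x, k (-x) = k x)
    (hf : Integrable f volume) :
    Integrable (fun z : Plane × Plane => k (z.1 - z.2) * f z.1) volume := by
  have h := integrable_kernel_mul_snd hk hf
  change Integrable _ ((volume : Measure Plane).prod volume) at h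
  refine h.swap.congr (Eventually.of_forall fun z => ?_)
  simp only [Function.comp_apply, Prod.fst_swap, Prod.snd_swap]
  rw [← neg_sub z.1 z.2, hs]

lemma integral_kernel_mul_fst (hk : Integrable k volume) (hs : ∀ x, k (-x) = k x)
    (hf : Integrable f volume) :
    ∫ z : Plane × Plane, k (z.1 - z.2) * f z.1 = (∫ x, k x) * ∫ x, f x := by
  rw [← integral_kernel_mul_snd hk hf]
  change ∫ z, _ ∂((volume : Measure Plane).prod volume)
    = ∫ z, _ ∂((volume : Measure Plane).prod volume)
  rw [← integral_prod_swap]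
  congr 1
  funext z
  simp only [Prod.fst_swap, Prod.snd_swap]
  rw [← neg_sub z.1 z.2, hs]

lemma aestronglyMeasurable_kernel_mul (hk : Measurable k) (hf : AEStronglyMeasurable f volume)
    (hg : AEStronglyMeasurable g volume) :
    AEStronglyMeasurable (fun z : Plane × Plane => k (z.1 - z.2) * f z.1 * g z.2) volume :=
  ((hk.comp (measurable_fst.sub measurable_snd)).aestronglyMeasurable.mul hf.comp_fst).mul
    hg.comp_snd

/-- A form of the Young inequality: `∬ k(x - y) |f(x)| |g(y)| ≤ ‖k‖₁ ‖f‖₂ ‖g‖₂`. -/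
lemma integrable_and_integral_kernel_le (hkm : Measurable k) (hk : Integrable k volume)
    (hk0 : ∀ x, 0 ≤ k x) (hs : ∀ x, k (-x) = k x) (hf : MemLp f 2 volume) (hg : MemLp g 2 volume) :
    Integrable (fun z : Plane × Plane => k (z.1 - z.2) * |f z.1| * |g z.2|) volume ∧
    ∫ z : Plane × Plane, k (z.1 - z.2) * |f z.1| * |g z.2|
      ≤ (∫ x, k x) * (√(∫ x, f x ^ 2) * √(∫ x, g x ^ 2)) := by
  have i1 := integrable_kernel_mul_fst hk hs hf.integrable_sq
  have i2 := integrable_kernel_mul_snd hk hg.integrable_sq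
  have hsq := fun x => Real.mul_self_sqrt (hk0 x)
  have e1 : ∀ z : Plane × Plane, (√(k (z.1 - z.2)) * |f z.1|) ^ 2
      = k (z.1 - z.2) * f z.1 ^ 2 := fun z => by rw [mul_pow, Real.sq_sqrt (hk0 _), sq_abs]
  have e2 : ∀ z : Plane × Plane, (√(k (z.1 - z.2)) * |g z.2|) ^ 2
      = k (z.1 - z.2) * g z.2 ^ 2 := fun z => by rw [mul_pow, Real.sq_sqrt (hk0 _), sq_abs]
  have e3 : ∀ z : Plane × Plane, (√(k (z.1 - z.2)) * |f z.1|) * (√(k (z.1 - z.2)) * |g z.2|)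
      = k (z.1 - z.2) * |f z.1| * |g z.2| := fun z => by
    rw [mul_mul_mul_comm, hsq, mul_assoc]
  have i3 : Integrable (fun z : Plane × Plane => k (z.1 - z.2) * |f z.1| * |g z.2|) volume := by
    refine (i1.add i2).mono' (aestronglyMeasurable_kernel_mul hkm hf.1.norm hg.1.norm)
      (Eventually.of_forall fun z => ?_)
    have h0 := hk0 (z.1 - z.2)
    rw [Real.norm_of_nonneg (by positivity)]
    simp only [Pi.add_apply]
    rw [mul_assoc, ← mul_add]
    refine mul_le_mul_of_nonneg_left ?_ h0
    rw [← sq_abs (f z.1), ← sq_abs (g z.2)]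
    nlinarith [sq_nonneg (|f z.1| - |g z.2|), sq_nonneg (|f z.1|), sq_nonneg (|g z.2|)]
  refine ⟨i3, ?_⟩
  -- Cauchy–Schwarz on the product, with the kernel shared as `√k · √k`, leaves integrals that each
  -- involve one of the two functions.
  have h := sq_integral_mul_le (μ := (volume : Measure (Plane × Plane)))
    (f := fun z : Plane × Plane => √(k (z.1 - z.2)) * |f z.1|)
    (g := fun z : Plane × Plane => √(k (z.1 - z.2)) * |g z.2|)
    (by simpa only [e1] using i1) (by simpa only [e2] using i2) (by simpa only [e3] using i3)
  simp only [e1, e2, e3] at h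
  rw [integral_kernel_mul_fst hk hs hf.integrable_sq,
    integral_kernel_mul_snd hk hg.integrable_sq] at h
  have hf0 : 0 ≤ ∫ x, f x ^ 2 := integral_nonneg fun x => sq_nonneg _
  have hg0 : 0 ≤ ∫ x, g x ^ 2 := integral_nonneg fun x => sq_nonneg _
  have hk1 : 0 ≤ ∫ x, k x := integral_nonneg hk0
  refine le_of_sq_le_sq ?_ (by positivity)
  rw [mul_pow, mul_pow, Real.sq_sqrt hf0, Real.sq_sqrt hg0]
  linarith

end KernelForm

/-- The kernel `log (1 + 1 / |x|)` restricted to the unit ball. -/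
def singularKernel (x : Plane) : ℝ := if ‖x‖ < 1 then Real.log (1 + 1 / ‖x‖) else 0

lemma log_one_add_inv_nonneg {r : ℝ} (hr : 0 ≤ r) : 0 ≤ Real.log (1 + 1 / r) :=
  Real.log_nonneg (by have : 0 ≤ 1 / r := by positivity
                      linarith)

lemma singularKernel_nonneg (x : Plane) : 0 ≤ singularKernel x := by
  unfold singularKernel
  split_ifs
  · exact log_one_add_inv_nonneg (norm_nonneg x)
  · exact le_rfl

lemma singularKernel_neg (x : Plane) : singularKernel (-x) = singularKernel x := by
  simp [singularKernel]

lemma measurable_singularKernel : Measurable singularKernel := by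
  unfold singularKernel
  refine Measurable.ite (measurableSet_lt measurable_norm measurable_const) ?_ measurable_const
  fun_prop

/-- In polar coordinates the Jacobian `r` absorbs the singularity, because `log(1 + 1/r) ≤ 1/r`. -/
lemma integrable_singularKernel : Integrable singularKernel volume := by
  have h := (integrable_fun_norm_addHaar (volume : Measure Plane)
    (f := fun r : ℝ => if r < 1 then Real.log (1 + 1 / r) else 0)).2 ?_
  · exact h
  have hb : IntegrableOn (fun r : ℝ => Set.indicator (Set.Ioo (0 : ℝ) 1) (fun _ => (1 : ℝ)) r)
      (Set.Ioi 0) volume :=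
    ((integrable_indicator_iff measurableSet_Ioo).2 (by simp)).integrableOn
  refine hb.mono' ?_ ?_
  · refine Measurable.aestronglyMeasurable ?_
    refine Measurable.smul (measurable_id.pow_const _) ?_
    exact Measurable.ite measurableSet_Iio (by fun_prop) measurable_const
  · rw [ae_restrict_iff' measurableSet_Ioi]
    refine Eventually.of_forall fun r hr => ?_
    have hr : 0 < r := hr
    by_cases h1 : r < 1
    · have h2 : Real.log (1 + 1 / r) ≤ 1 / r := by
        have : 0 < 1 / r := by positivity
        linarith [Real.log_le_sub_one_of_pos (show 0 < 1 + 1 / r by linarith)]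
      have h3 := log_one_add_inv_nonneg hr.le
      simp only [finrank_euclideanSpace, Fintype.card_fin, h1, if_true, smul_eq_mul]
      rw [Set.indicator_of_mem (show r ∈ Set.Ioo (0 : ℝ) 1 from ⟨hr, h1⟩)]
      rw [Real.norm_of_nonneg (by positivity)]
      calc r ^ (2 - 1) * Real.log (1 + 1 / r) ≤ r ^ (2 - 1) * (1 / r) := by gcongr
        _ = 1 := by norm_num; field_simp
    · simp only [h1, if_false, smul_zero, norm_zero]
      exact Set.indicator_nonneg (fun _ _ => zero_le_one) _

/-- Splits the kernel of `B₂` into a bounded part and an integrable part: outside the unit ball it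
is at most `log 2`. -/
lemma log_one_add_inv_le (x : Plane) :
    Real.log (1 + 1 / ‖x‖) ≤ Real.log 2 + singularKernel x := by
  have h2 : 0 ≤ Real.log 2 := Real.log_nonneg (by norm_num)
  unfold singularKernel
  split_ifs with h
  · linarith
  · push Not at h
    rw [add_zero]
    refine Real.log_le_log (by positivity) ?_
    have : 1 / ‖x‖ ≤ 1 := (div_le_one (by linarith)).2 h
    linarith

/-- Logarithm of `1 + |x - y| ≤ (1 + |x|)(1 + |y|)`. -/
lemma log_one_add_norm_sub_le (x y : Plane) :
    Real.log (1 + ‖x - y‖) ≤ logWeight x + logWeight y := by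
  unfold logWeight
  rw [← Real.log_mul (by positivity) (by positivity)]
  refine Real.log_le_log (by positivity) ?_
  nlinarith [norm_sub_le x y, norm_nonneg x, norm_nonneg y, mul_nonneg (norm_nonneg x) (norm_nonneg y)]

lemma integrable_and_abs_B₁_le {f g : Plane → ℝ} (hf : LogIntegrable f) (hg : LogIntegrable g) :
    Integrable (fun z : Plane × Plane => Real.log (1 + ‖z.1 - z.2‖) * f z.1 * g z.2) volume ∧
    |B₁ f g| ≤ logSize f * logSize g := by
  have i1 : Integrable (fun z : Plane × Plane => (logWeight z.1 * |f z.1|) * |g z.2|) volume :=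
    hf.weighted_abs.mul_prod hg.integrable.abs
  have i2 : Integrable (fun z : Plane × Plane => |f z.1| * (logWeight z.2 * |g z.2|)) volume :=
    hf.integrable.abs.mul_prod hg.weighted_abs
  have hpt : ∀ z : Plane × Plane, ‖Real.log (1 + ‖z.1 - z.2‖) * f z.1 * g z.2‖
      ≤ (logWeight z.1 * |f z.1|) * |g z.2| + |f z.1| * (logWeight z.2 * |g z.2|) := by
    intro z
    have h := log_one_add_norm_sub_le z.1 z.2
    have h0 : 0 ≤ Real.log (1 + ‖z.1 - z.2‖) := logWeight_nonneg _
    rw [norm_mul, norm_mul, Real.norm_of_nonneg h0, Real.norm_eq_abs, Real.norm_eq_abs]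
    calc Real.log (1 + ‖z.1 - z.2‖) * |f z.1| * |g z.2|
        ≤ (logWeight z.1 + logWeight z.2) * |f z.1| * |g z.2| := by gcongr
      _ = _ := by ring
  refine ⟨(i1.add i2).mono' (aestronglyMeasurable_kernel_mul
    (k := fun x => Real.log (1 + ‖x‖)) (by fun_prop) hf.integrable.1 hg.integrable.1)
    (Eventually.of_forall hpt), ?_⟩
  have h := norm_integral_le_of_norm_le (i1.add i2) (Eventually.of_forall hpt)
  simp only [Pi.add_apply] at h
  rw [integral_add i1 i2] at h
  have e1 : ∫ z : Plane × Plane, (logWeight z.1 * |f z.1|) * |g z.2|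
      = (∫ x, logWeight x * |f x|) * ∫ x, |g x| :=
    integral_prod_mul (fun x => logWeight x * |f x|) (fun x => |g x|)
  have e2 : ∫ z : Plane × Plane, |f z.1| * (logWeight z.2 * |g z.2|)
      = (∫ x, |f x|) * ∫ x, logWeight x * |g x| :=
    integral_prod_mul (fun x => |f x|) (fun x => logWeight x * |g x|)
  rw [e1, e2] at h
  refine h.trans ?_
  have a1 := integral_abs_nonneg f
  have a2 := integral_abs_nonneg g
  have b1 := integral_logWeight_abs_nonneg f
  have b2 := integral_logWeight_abs_nonneg g
  have c1 := Real.sqrt_nonneg (∫ x, f x ^ 2)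
  have c2 := Real.sqrt_nonneg (∫ x, g x ^ 2)
  unfold logSize
  have := mul_nonneg a1 a2
  have := mul_nonneg b1 b2
  have := mul_nonneg (add_nonneg a1 b1) c2
  have := mul_nonneg c1 (add_nonneg (add_nonneg a2 b2) c2)
  nlinarith

/-- The constant in the bound of `B₂`. -/
def singularConst : ℝ := Real.log 2 + ∫ x, singularKernel x

lemma singularConst_nonneg : 0 ≤ singularConst :=
  add_nonneg (Real.log_nonneg (by norm_num)) (integral_nonneg singularKernel_nonneg)

/-- The bounded part of the kernel is paid for with `L¹` norms, the integrable part with `L²` norms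
by Young. No logarithmic weight enters the bound, so `B₂(u², u²)` is controlled before the norm of
`X` is. -/
lemma integrable_and_abs_B₂_le {f g : Plane → ℝ} (hf : LogIntegrable f) (hg : LogIntegrable g) :
    Integrable (fun z : Plane × Plane => Real.log (1 + 1 / ‖z.1 - z.2‖) * f z.1 * g z.2) volume ∧
    |B₂ f g| ≤ singularConst * ((∫ x, |f x|) * (∫ x, |g x|)
      + √(∫ x, f x ^ 2) * √(∫ x, g x ^ 2)) := by
  have i1 : Integrable (fun z : Plane × Plane => Real.log 2 * (|f z.1| * |g z.2|)) volume :=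
    (hf.integrable.abs.mul_prod hg.integrable.abs).const_mul _
  obtain ⟨i2, hle⟩ := integrable_and_integral_kernel_le measurable_singularKernel
    integrable_singularKernel singularKernel_nonneg singularKernel_neg
    ((memLp_two_iff_integrable_sq hf.integrable.1).2 hf.sq)
    ((memLp_two_iff_integrable_sq hg.integrable.1).2 hg.sq)
  have hpt : ∀ z : Plane × Plane, ‖Real.log (1 + 1 / ‖z.1 - z.2‖) * f z.1 * g z.2‖
      ≤ Real.log 2 * (|f z.1| * |g z.2|) + singularKernel (z.1 - z.2) * |f z.1| * |g z.2| := by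
    intro z
    have h := log_one_add_inv_le (z.1 - z.2)
    have h0 := log_one_add_inv_nonneg (norm_nonneg (z.1 - z.2))
    rw [norm_mul, norm_mul, Real.norm_of_nonneg h0, Real.norm_eq_abs, Real.norm_eq_abs]
    calc Real.log (1 + 1 / ‖z.1 - z.2‖) * |f z.1| * |g z.2|
        ≤ (Real.log 2 + singularKernel (z.1 - z.2)) * |f z.1| * |g z.2| := by gcongr
      _ = _ := by ring
  refine ⟨(i1.add i2).mono' (aestronglyMeasurable_kernel_mul
    (k := fun x => Real.log (1 + 1 / ‖x‖)) (by fun_prop) hf.integrable.1 hg.integrable.1)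
    (Eventually.of_forall hpt), ?_⟩
  have h := norm_integral_le_of_norm_le (i1.add i2) (Eventually.of_forall hpt)
  simp only [Pi.add_apply] at h
  have e1 : ∫ z : Plane × Plane, |f z.1| * |g z.2| = (∫ x, |f x|) * ∫ x, |g x| :=
    integral_prod_mul (fun x => |f x|) (fun x => |g x|)
  rw [integral_add i1 i2, integral_const_mul, e1] at h
  refine h.trans ((add_le_add_right hle _).trans ?_)
  have a := mul_nonneg (integral_abs_nonneg f) (integral_abs_nonneg g)
  have b := mul_nonneg (Real.sqrt_nonneg (∫ x, f x ^ 2)) (Real.sqrt_nonneg (∫ x, g x ^ 2))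
  have c : 0 ≤ Real.log 2 := Real.log_nonneg (by norm_num)
  have d : 0 ≤ ∫ x, singularKernel x := integral_nonneg singularKernel_nonneg
  unfold singularConst
  nlinarith [mul_nonneg c b, mul_nonneg d a]

section Forms

variable {f f' g g' : Plane → ℝ}

lemma B₁_eq_kernelForm : B₁ f g = kernelForm (fun x => Real.log (1 + ‖x‖)) f g := rfl

lemma B₂_eq_kernelForm : B₂ f g = kernelForm (fun x => Real.log (1 + 1 / ‖x‖)) f g := rfl

lemma B₀_congr (hf : f =ᵐ[volume] f') (hg : g =ᵐ[volume] g') : B₀ f g = B₀ f' g' := by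
  simp only [B₀, B₁_eq_kernelForm, B₂_eq_kernelForm, kernelForm_congr hf hg]

lemma B₀_symm : B₀ f g = B₀ g f := by
  simp only [B₀, B₁_eq_kernelForm, B₂_eq_kernelForm]
  rw [kernelForm_symm (k := fun x => Real.log (1 + ‖x‖)) (by simp),
    kernelForm_symm (k := fun x => Real.log (1 + 1 / ‖x‖)) (by simp)]

lemma B₀_const_mul_left (r : ℝ) : B₀ (fun x => r * f x) g = r * B₀ f g := by
  simp only [B₀, B₁_eq_kernelForm, B₂_eq_kernelForm, kernelForm_const_mul_left]
  ring

lemma B₀_add_left (hf : LogIntegrable f) (hf' : LogIntegrable f') (hg : LogIntegrable g) :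
    B₀ (fun x => f x + f' x) g = B₀ f g + B₀ f' g := by
  simp only [B₀, B₁_eq_kernelForm, B₂_eq_kernelForm]
  rw [kernelForm_add_left (k := fun x => Real.log (1 + ‖x‖)) (integrable_and_abs_B₁_le hf hg).1
      (integrable_and_abs_B₁_le hf' hg).1,
    kernelForm_add_left (k := fun x => Real.log (1 + 1 / ‖x‖)) (integrable_and_abs_B₂_le hf hg).1
      (integrable_and_abs_B₂_le hf' hg).1]
  ring

lemma B₀_const_mul_right (r : ℝ) : B₀ f (fun x => r * g x) = r * B₀ f g := by
  rw [B₀_symm, B₀_const_mul_left, B₀_symm]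

lemma B₀_add_right (hf : LogIntegrable f) (hg : LogIntegrable g) (hg' : LogIntegrable g') :
    B₀ f (fun x => g x + g' x) = B₀ f g + B₀ f g' := by
  rw [B₀_symm, B₀_add_left hg hg' hf, B₀_symm, B₀_symm (f := g')]

lemma abs_B₀_le (hf : LogIntegrable f) (hg : LogIntegrable g) :
    |B₀ f g| ≤ (1 + 2 * singularConst) * (logSize f * logSize g) := by
  have h1 := (integrable_and_abs_B₁_le hf hg).2
  have h2 := (integrable_and_abs_B₂_le hf hg).2
  have a1 : ∫ x, |f x| ≤ logSize f := by
    have := integral_logWeight_abs_nonneg f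
    have := Real.sqrt_nonneg (∫ x, f x ^ 2)
    unfold logSize; linarith
  have a2 : ∫ x, |g x| ≤ logSize g := by
    have := integral_logWeight_abs_nonneg g
    have := Real.sqrt_nonneg (∫ x, g x ^ 2)
    unfold logSize; linarith
  have b1 : √(∫ x, f x ^ 2) ≤ logSize f := by
    have := integral_logWeight_abs_nonneg f
    have := integral_abs_nonneg f
    unfold logSize; linarith
  have b2 : √(∫ x, g x ^ 2) ≤ logSize g := by
    have := integral_logWeight_abs_nonneg g
    have := integral_abs_nonneg g
    unfold logSize; linarith
  have c1 := mul_le_mul a1 a2 (integral_abs_nonneg g) (logSize_nonneg f)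
  have c2 := mul_le_mul b1 b2 (Real.sqrt_nonneg _) (logSize_nonneg f)
  have c3 := mul_le_mul_of_nonneg_left (add_le_add c1 c2) singularConst_nonneg
  have h3 : |B₀ f g| ≤ |B₁ f g| + |B₂ f g| := abs_sub _ _
  linarith

end Forms

/-! ### Elementary inequalities and a differentiability criterion -/

section CauchySchwarz

variable {α : Type*} [MeasurableSpace α] {μ : Measure α}

lemma abs_integral_mul_le {f g : α → ℝ} (hf : Integrable (fun x => f x ^ 2) μ)
    (hg : Integrable (fun x => g x ^ 2) μ) (hfg : Integrable (fun x => f x * g x) μ) :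
    |∫ x, f x * g x ∂μ| ≤ √(∫ x, f x ^ 2 ∂μ) * √(∫ x, g x ^ 2 ∂μ) := by
  refine abs_le_of_sq_le_sq ?_ (by positivity)
  rw [mul_pow, Real.sq_sqrt (integral_nonneg fun x => sq_nonneg _),
    Real.sq_sqrt (integral_nonneg fun x => sq_nonneg _)]
  exact sq_integral_mul_le hf hg hfg

lemma integral_weight_abs_mul_le {w f g : α → ℝ} (hw : ∀ x, 0 ≤ w x)
    (hf : Integrable (fun x => w x * f x ^ 2) μ) (hg : Integrable (fun x => w x * g x ^ 2) μ)
    (hfg : Integrable (fun x => w x * (f x * g x)) μ) :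
    ∫ x, w x * |f x * g x| ∂μ ≤ √(∫ x, w x * f x ^ 2 ∂μ) * √(∫ x, w x * g x ^ 2 ∂μ) := by
  have e : ∀ h : α → ℝ, ∀ x, (√(w x) * |h x|) ^ 2 = w x * h x ^ 2 := fun h x => by
    rw [mul_pow, Real.sq_sqrt (hw x), sq_abs]
  have e3 : ∀ x, (√(w x) * |f x|) * (√(w x) * |g x|) = w x * |f x * g x| := fun x => by
    rw [mul_mul_mul_comm, Real.mul_self_sqrt (hw x), abs_mul]
  have h3 : Integrable (fun x => w x * |f x * g x|) μ := by
    refine hfg.abs.congr (Eventually.of_forall fun x => ?_)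
    simp only [abs_mul, abs_of_nonneg (hw x)]
  have h := abs_integral_mul_le (μ := μ) (f := fun x => √(w x) * |f x|)
    (g := fun x => √(w x) * |g x|) (by simpa only [e] using hf) (by simpa only [e] using hg)
    (by simpa only [e3] using h3)
  simp only [e, e3] at h
  exact (le_abs_self _).trans h

end CauchySchwarz

/-- The square dominates for `|t| ≤ 1` and the higher power for `|t| ≥ 1`. This reduces real
exponents to even integer ones. -/
lemma abs_rpow_le_sq_add_pow {q : ℝ} (hq : 2 ≤ q) {k : ℕ} (hk : q ≤ 2 * (k + 1)) (t : ℝ) :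
    |t| ^ q ≤ t ^ 2 + t ^ (2 * (k + 1)) := by
  have h1 : 0 ≤ t ^ 2 := sq_nonneg t
  have h2 : 0 ≤ t ^ (2 * (k + 1)) := (even_two_mul _).pow_nonneg t
  rcases le_total |t| 1 with h | h
  · rcases eq_or_ne t 0 with rfl | ht
    · rw [abs_zero, Real.zero_rpow (by linarith)]
      positivity
    · have := Real.rpow_le_rpow_of_exponent_ge (abs_pos.2 ht) h hq
      rw [Real.rpow_two, sq_abs] at this
      linarith
  · have := Real.rpow_le_rpow_of_exponent_le h hk
    have e : |t| ^ (2 * ((k : ℝ) + 1)) = t ^ (2 * (k + 1)) := by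
      rw [show (2 * ((k : ℝ) + 1)) = ((2 * (k + 1) : ℕ) : ℝ) by push_cast; ring,
        Real.rpow_natCast, (even_two_mul _).pow_abs]
    linarith

/-- Second-order Taylor estimate of `|t|ᵖ`. -/
lemma abs_rpow_taylor {p : ℝ} (hp : 4 < p) (a b : ℝ) :
    |(|a + b| ^ p - |a| ^ p - p * |a| ^ (p - 2) * a * b)|
      ≤ p * (p - 1) * 2 ^ (p - 2) * (|a| ^ (p - 2) * b ^ 2 + |b| ^ p) := by
  -- This function is the derivative of `|t|ᵖ`. The mean value inequality on the ball of radius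
  -- `|b|` about `a` is used twice: for this derivative, then for `|t|ᵖ` minus its linear part at
  -- `a`.
  have hψ : ∀ t : ℝ, HasDerivAt (fun t : ℝ => p * |t| ^ (p - 2) * t)
      (p * (p - 1) * |t| ^ (p - 2)) t := by
    intro t
    have h := ((hasDerivAt_abs_rpow t (show 1 < p - 2 by linarith)).const_mul p).mul
      (hasDerivAt_id t)
    refine h.congr_deriv ?_
    have e : |t| ^ (p - 2 - 2) * t * t = |t| ^ (p - 2) := by
      rcases eq_or_ne t 0 with rfl | ht
      · rw [abs_zero, Real.zero_rpow (by linarith), Real.zero_rpow (by linarith)]; ring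
      · rw [mul_assoc, ← sq, ← sq_abs t, ← Real.rpow_two, ← Real.rpow_add (abs_pos.2 ht)]
        congr 1; ring
    simp only [id, mul_one]
    linear_combination (p * (p - 2)) * e
  have hball : ∀ t ∈ Metric.closedBall a |b|, |t| ≤ |a| + |b| := by
    intro t ht
    rw [Metric.mem_closedBall, Real.dist_eq] at ht
    have := abs_add_le a (t - a)
    rw [add_sub_cancel] at this
    linarith
  have ha : a ∈ Metric.closedBall a |b| := Metric.mem_closedBall_self (abs_nonneg b)
  have hab : a + b ∈ Metric.closedBall a |b| := by simp [Metric.mem_closedBall]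
  have h1 : ∀ t ∈ Metric.closedBall a |b|,
      ‖p * |t| ^ (p - 2) * t - p * |a| ^ (p - 2) * a‖
        ≤ p * (p - 1) * (|a| + |b|) ^ (p - 2) * |b| := by
    intro t ht
    have hb : ∀ s ∈ Metric.closedBall a |b|, ‖p * (p - 1) * |s| ^ (p - 2)‖
        ≤ p * (p - 1) * (|a| + |b|) ^ (p - 2) := by
      intro s hs
      have hp1 : 0 ≤ p * (p - 1) := by nlinarith
      rw [Real.norm_of_nonneg (by positivity)]
      exact mul_le_mul_of_nonneg_left
        (Real.rpow_le_rpow (abs_nonneg s) (hball s hs) (by linarith)) hp1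
    have h := (convex_closedBall a |b|).norm_image_sub_le_of_norm_hasDerivWithin_le
      (fun s _ => (hψ s).hasDerivWithinAt) hb ha ht
    refine h.trans ?_
    have hp1 : 0 ≤ p * (p - 1) := by nlinarith
    have : ‖t - a‖ ≤ |b| := by rwa [Metric.mem_closedBall, Real.dist_eq] at ht
    gcongr
  have h2 := (convex_closedBall a |b|).norm_image_sub_le_of_norm_hasDerivWithin_le
    (f := fun t : ℝ => |t| ^ p - p * |a| ^ (p - 2) * a * t)
    (f' := fun t => p * |t| ^ (p - 2) * t - p * |a| ^ (p - 2) * a)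
    (fun t _ => ((hasDerivAt_abs_rpow t (show 1 < p by linarith)).sub
      (by simpa using (hasDerivAt_id t).const_mul (p * |a| ^ (p - 2) * a))).hasDerivWithinAt)
    h1 ha hab
  have e2 : |a + b| ^ p - p * |a| ^ (p - 2) * a * (a + b) - (|a| ^ p - p * |a| ^ (p - 2) * a * a)
      = |a + b| ^ p - |a| ^ p - p * |a| ^ (p - 2) * a * b := by ring
  simp only [e2, add_sub_cancel_left, Real.norm_eq_abs] at h2
  refine h2.trans ?_
  have h3 : (|a| + |b|) ^ (p - 2) ≤ 2 ^ (p - 2) * (|a| ^ (p - 2) + |b| ^ (p - 2)) := by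
    have hA : 0 ≤ |a| ^ (p - 2) := by positivity
    have hB : 0 ≤ |b| ^ (p - 2) := by positivity
    have h20 : (0 : ℝ) ≤ 2 ^ (p - 2) := by positivity
    rcases le_total |a| |b| with h | h
    · calc (|a| + |b|) ^ (p - 2) ≤ (2 * |b|) ^ (p - 2) :=
            Real.rpow_le_rpow (by positivity) (by linarith) (by linarith)
        _ = 2 ^ (p - 2) * |b| ^ (p - 2) := Real.mul_rpow (by norm_num) (abs_nonneg _)
        _ ≤ _ := mul_le_mul_of_nonneg_left (by linarith) h20
    · calc (|a| + |b|) ^ (p - 2) ≤ (2 * |a|) ^ (p - 2) :=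
            Real.rpow_le_rpow (by positivity) (by linarith) (by linarith)
        _ = 2 ^ (p - 2) * |a| ^ (p - 2) := Real.mul_rpow (by norm_num) (abs_nonneg _)
        _ ≤ _ := mul_le_mul_of_nonneg_left (by linarith) h20
  have e4 : |b| ^ (p - 2) * b ^ 2 = |b| ^ p := by
    rcases eq_or_ne b 0 with rfl | hb
    · rw [abs_zero, Real.zero_rpow (by linarith), Real.zero_rpow (by linarith)]; ring
    · rw [← sq_abs b, ← Real.rpow_two, ← Real.rpow_add (abs_pos.2 hb)]
      congr 1; ring
  have hp1 : 0 ≤ p * (p - 1) := by nlinarith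
  calc p * (p - 1) * (|a| + |b|) ^ (p - 2) * |b| * |b|
      = p * (p - 1) * (|a| + |b|) ^ (p - 2) * b ^ 2 := by rw [mul_assoc _ |b|, abs_mul_abs_self, sq]
    _ ≤ p * (p - 1) * (2 ^ (p - 2) * (|a| ^ (p - 2) + |b| ^ (p - 2))) * b ^ 2 := by gcongr
    _ = p * (p - 1) * 2 ^ (p - 2) * (|a| ^ (p - 2) * b ^ 2 + |b| ^ (p - 2) * b ^ 2) := by ring
    _ = _ := by rw [e4]

/-- A function with a bounded linear approximation and a quadratic remainder is differentiable. -/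
lemma differentiableAt_of_quadratic_remainder {E : Type*} [NormedAddCommGroup E] [NormedSpace ℝ E]
    {J : E → ℝ} {u : E} (L : E →ₗ[ℝ] ℝ) {C D : ℝ} (hL : ∀ h, |L h| ≤ C * ‖h‖)
    (hR : ∀ h, ‖h‖ ≤ 1 → |J (u + h) - J u - L h| ≤ D * ‖h‖ ^ 2) : DifferentiableAt ℝ J u := by
  have key : HasFDerivAt J (L.mkContinuous C hL) u := by
    rw [hasFDerivAt_iff_isLittleO_nhds_zero]
    have h1 : (fun h : E => J (u + h) - J u - L.mkContinuous C hL h)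
        =O[𝓝 0] fun h => ‖h‖ ^ 2 := by
      refine Asymptotics.IsBigO.of_bound D ?_
      filter_upwards [Metric.closedBall_mem_nhds (0 : E) one_pos] with h hh
      rw [mem_closedBall_zero_iff] at hh
      rw [Real.norm_of_nonneg (sq_nonneg ‖h‖)]
      exact hR h hh
    have h2 : (fun h : E => ‖h‖ ^ 2) =o[𝓝 0] fun h => h := by
      have := Asymptotics.isLittleO_norm_pow_id (E' := E) one_lt_two
      simpa using this
    exact h1.trans_isLittleO h2
  exact key.differentiableAt

/-! ### Sobolev embeddings of `X` and continuity of the forms on it -/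

section Estimates

variable {V : Plane → ℝ} {hV : PotentialAssumption V}

/-- The energy `∫ (|∇u|² + V u²)`. -/
def X.energy (u : X hV) : ℝ := ∫ x, (‖X.grad u x‖ ^ 2 + V x * X.fn u x ^ 2)

lemma X.memLp_fn (u : X hV) : MemLp (X.fn u) 2 volume := Lp.memLp (u.1 : L2)

lemma X.integrable_sq (u : X hV) : Integrable (fun x => X.fn u x ^ 2) volume :=
  u.memLp_fn.integrable_sq

lemma X.integrable_grad_sq (u : X hV) : Integrable (fun x => ‖X.grad u x‖ ^ 2) volume :=
  (Lp.memLp (H1.grad (X.toH1 u))).norm.integrable_sq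

lemma X.integrable_logWeight_sq (u : X hV) :
    Integrable (fun x => logWeight x * X.fn u x ^ 2) volume := u.2.2.1

lemma X.integrable_potential_sq (u : X hV) :
    Integrable (fun x => V x * X.fn u x ^ 2) volume := u.2.2.2

lemma X.energy_eq (u : X hV) :
    X.energy u = (∫ x, ‖X.grad u x‖ ^ 2) + ∫ x, V x * X.fn u x ^ 2 :=
  integral_add u.integrable_grad_sq u.integrable_potential_sq

lemma X.norm_sq_eq (u : X hV) : ‖u‖ ^ 2 = X.energy u + ∫ x, logWeight x * X.fn u x ^ 2 := by
  rw [X.norm_sq]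
  exact integral_add (u.integrable_grad_sq.add u.integrable_potential_sq)
    u.integrable_logWeight_sq

lemma X.integral_sq_nonneg (u : X hV) : 0 ≤ ∫ x, X.fn u x ^ 2 := integral_nonneg fun _ => sq_nonneg _

lemma X.integral_potential_sq_nonneg (u : X hV) : 0 ≤ ∫ x, V x * X.fn u x ^ 2 :=
  integral_nonneg fun x => mul_nonneg (hV.pos x).le (sq_nonneg _)

lemma X.integral_grad_sq_nonneg (u : X hV) : 0 ≤ ∫ x, ‖X.grad u x‖ ^ 2 :=
  integral_nonneg fun _ => by positivity

lemma X.energy_nonneg (u : X hV) : 0 ≤ X.energy u := by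
  rw [X.energy_eq]
  exact add_nonneg u.integral_grad_sq_nonneg u.integral_potential_sq_nonneg

lemma X.integral_logWeight_sq_nonneg (u : X hV) : 0 ≤ ∫ x, logWeight x * X.fn u x ^ 2 :=
  integral_nonneg fun x => mul_nonneg (logWeight_nonneg x) (sq_nonneg _)

lemma X.energy_le_norm_sq (u : X hV) : X.energy u ≤ ‖u‖ ^ 2 := by
  rw [X.norm_sq_eq]
  linarith [u.integral_logWeight_sq_nonneg]

lemma X.integral_logWeight_sq_le_norm_sq (u : X hV) :
    ∫ x, logWeight x * X.fn u x ^ 2 ≤ ‖u‖ ^ 2 := by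
  rw [X.norm_sq_eq]
  linarith [u.energy_nonneg]

variable (hV) in
lemma X.exists_integral_sq_le_energy :
    ∃ C : ℝ, 0 ≤ C ∧ ∀ u : X hV, ∫ x, X.fn u x ^ 2 ≤ C * X.energy u := by
  obtain ⟨m, hm, hmV⟩ := hV.inf_pos
  refine ⟨m⁻¹, by positivity, fun u => ?_⟩
  have h : m * ∫ x, X.fn u x ^ 2 ≤ ∫ x, V x * X.fn u x ^ 2 := by
    rw [← integral_const_mul]
    exact integral_mono (u.integrable_sq.const_mul m) u.integrable_potential_sq
      fun x => mul_le_mul_of_nonneg_right (hmV x) (sq_nonneg _)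
  rw [le_inv_mul_iff₀ hm, X.energy_eq]
  linarith [u.integral_grad_sq_nonneg]

variable (hV) in
/-- The Sobolev embedding of `X` in even exponents. -/
lemma X.exists_integral_pow_le (k : ℕ) : ∃ C : ℝ, 0 ≤ C ∧ ∀ u : X hV,
    Integrable (fun x => X.fn u x ^ (2 * (k + 1))) volume ∧
    ∫ x, X.fn u x ^ (2 * (k + 1)) ≤ C * (∫ x, X.fn u x ^ 2) * X.energy u ^ k := by
  obtain ⟨C, hC, h⟩ := exists_integral_pow_le_of_isWeakGradient k
  obtain ⟨K, hK, hKe⟩ := X.exists_integral_sq_le_energy hV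
  refine ⟨C * (K + 1) ^ k, by positivity, fun u => ?_⟩
  obtain ⟨h1, h2⟩ := h _ _ (H1.grad_spec (X.toH1 u))
  refine ⟨h1, h2.trans ?_⟩
  have h3 : (∫ x, X.fn u x ^ 2) + ∫ x, ‖X.grad u x‖ ^ 2 ≤ (K + 1) * X.energy u := by
    have := hKe u
    have := X.energy_eq u
    linarith [u.integral_potential_sq_nonneg]
  have h4 := u.integral_sq_nonneg
  have h5 := add_nonneg h4 u.integral_grad_sq_nonneg
  calc C * (∫ x, X.fn u x ^ 2) * ((∫ x, X.fn u x ^ 2) + ∫ x, ‖X.grad u x‖ ^ 2) ^ k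
      ≤ C * (∫ x, X.fn u x ^ 2) * ((K + 1) * X.energy u) ^ k := by gcongr
    _ = _ := by rw [mul_pow]; ring

variable (hV) in
lemma X.exists_integral_pow_le_norm (k : ℕ) : ∃ C : ℝ, 0 ≤ C ∧ ∀ u : X hV,
    ∫ x, X.fn u x ^ (2 * (k + 1)) ≤ C * ‖u‖ ^ (2 * (k + 1)) := by
  obtain ⟨C, hC, h⟩ := X.exists_integral_pow_le hV k
  obtain ⟨K, hK, hKe⟩ := X.exists_integral_sq_le_energy hV
  refine ⟨C * K, by positivity, fun u => (h u).2.trans ?_⟩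
  have h0 := u.energy_nonneg
  have h1 : ∫ x, X.fn u x ^ 2 ≤ K * ‖u‖ ^ 2 :=
    (hKe u).trans (mul_le_mul_of_nonneg_left u.energy_le_norm_sq hK)
  have h2 := u.energy_le_norm_sq
  calc C * (∫ x, X.fn u x ^ 2) * X.energy u ^ k ≤ C * (K * ‖u‖ ^ 2) * (‖u‖ ^ 2) ^ k := by gcongr
    _ = C * K * ‖u‖ ^ (2 * (k + 1)) := by rw [pow_mul, pow_succ]; ring

lemma X.integrable_pow (u : X hV) (k : ℕ) :
    Integrable (fun x => X.fn u x ^ (2 * (k + 1))) volume := by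
  obtain ⟨C, -, h⟩ := X.exists_integral_pow_le hV k
  exact (h u).1

lemma exists_nat_rpow_le (q : ℝ) : ∃ k : ℕ, q ≤ 2 * ((k : ℝ) + 1) := by
  obtain ⟨k, hk⟩ := exists_nat_ge q
  exact ⟨k, by linarith [k.cast_nonneg (α := ℝ)]⟩

lemma X.integrable_rpow (u : X hV) {q : ℝ} (hq : 2 ≤ q) :
    Integrable (fun x => |X.fn u x| ^ q) volume := by
  obtain ⟨k, hk⟩ := exists_nat_rpow_le q
  refine (u.integrable_sq.add (u.integrable_pow k)).mono'
    (u.memLp_fn.1.aemeasurable.abs.pow_const q).aestronglyMeasurable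
    (Eventually.of_forall fun x => ?_)
  rw [Real.norm_of_nonneg (by positivity)]
  exact abs_rpow_le_sq_add_pow hq hk _

lemma X.integral_rpow_le (u : X hV) {q : ℝ} (hq : 2 ≤ q) {k : ℕ} (hk : q ≤ 2 * ((k : ℝ) + 1)) :
    ∫ x, |X.fn u x| ^ q ≤ (∫ x, X.fn u x ^ 2) + ∫ x, X.fn u x ^ (2 * (k + 1)) := by
  rw [← integral_add u.integrable_sq (u.integrable_pow k)]
  exact integral_mono (u.integrable_rpow hq) (u.integrable_sq.add (u.integrable_pow k))
    fun x => abs_rpow_le_sq_add_pow hq hk _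

lemma X.integrable_mul (u v : X hV) : Integrable (fun x => X.fn u x * X.fn v x) volume :=
  u.memLp_fn.integrable_mul v.memLp_fn

lemma X.integrable_logWeight_mul (u v : X hV) :
    Integrable (fun x => logWeight x * (X.fn u x * X.fn v x)) volume :=
  integrable_weight_mul logWeight_continuous.aestronglyMeasurable logWeight_nonneg
    u.2.2.1 v.2.2.1

lemma X.integrable_sq_mul_sq (u v : X hV) :
    Integrable (fun x => X.fn u x ^ 2 * X.fn v x ^ 2) volume := by
  refine ((u.integrable_pow 1).add (v.integrable_pow 1)).mono'
    ((u.memLp_fn.1.pow 2).mul (v.memLp_fn.1.pow 2)) (Eventually.of_forall fun x => ?_)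
  rw [Real.norm_of_nonneg (by positivity)]
  simp only [Pi.add_apply, Nat.reduceAdd, Nat.reduceMul]
  nlinarith [sq_nonneg (X.fn u x ^ 2 - X.fn v x ^ 2), sq_nonneg (X.fn u x ^ 2),
    sq_nonneg (X.fn v x ^ 2)]

lemma X.logIntegrable_mul (u v : X hV) : LogIntegrable (fun x => X.fn u x * X.fn v x) where
  integrable := u.integrable_mul v
  weighted := u.integrable_logWeight_mul v
  sq := by simpa only [mul_pow] using u.integrable_sq_mul_sq v

lemma X.logIntegrable_sq (u : X hV) : LogIntegrable (fun x => X.fn u x ^ 2) := by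
  simpa only [sq] using u.logIntegrable_mul u

variable (hV) in
-- Cauchy–Schwarz for each of the three terms of `logSize`: with weight 1, with the logarithmic
-- weight, and for the squares, where the `L⁴` embedding enters.
lemma X.exists_logSize_mul_le : ∃ C : ℝ, 0 ≤ C ∧ ∀ u v : X hV,
    logSize (fun x => X.fn u x * X.fn v x) ≤ C * (‖u‖ * ‖v‖) := by
  obtain ⟨K, hK, h2⟩ := X.exists_integral_pow_le_norm hV 0
  obtain ⟨M, hM, h4⟩ := X.exists_integral_pow_le_norm hV 1
  refine ⟨K + 1 + √M, by positivity, fun u v => ?_⟩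
  have s2 : ∀ u : X hV, √(∫ x, 1 * X.fn u x ^ 2) ≤ √K * ‖u‖ := by
    intro u
    rw [Real.sqrt_le_left (by positivity), mul_pow, Real.sq_sqrt hK]
    simpa using h2 u
  have s3 : ∀ u : X hV, √(∫ x, logWeight x * X.fn u x ^ 2) ≤ ‖u‖ := by
    intro u
    rw [Real.sqrt_le_left (by positivity)]
    exact u.integral_logWeight_sq_le_norm_sq
  have s4 : ∀ u : X hV, √(∫ x, 1 * (X.fn u x ^ 2) ^ 2) ≤ √M * ‖u‖ ^ 2 := by
    intro u
    rw [Real.sqrt_le_left (by positivity), mul_pow, Real.sq_sqrt hM]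
    simpa only [one_mul, ← pow_mul] using h4 u
  have b1 := integral_weight_abs_mul_le (μ := volume) (w := fun _ : Plane => (1 : ℝ))
    (fun _ => zero_le_one) (by simpa using u.integrable_sq) (by simpa using v.integrable_sq)
    (by simpa using u.integrable_mul v)
  have b2 := integral_weight_abs_mul_le (μ := volume) logWeight_nonneg u.integrable_logWeight_sq
    v.integrable_logWeight_sq (u.integrable_logWeight_mul v)
  have b3 := integral_weight_abs_mul_le (μ := volume) (w := fun _ : Plane => (1 : ℝ))
    (f := fun x => X.fn u x ^ 2) (g := fun x => X.fn v x ^ 2)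
    (fun _ => zero_le_one) (by simpa only [one_mul, ← pow_mul] using u.integrable_pow 1)
    (by simpa only [one_mul, ← pow_mul] using v.integrable_pow 1)
    (by simpa using u.integrable_sq_mul_sq v)
  have c1 := b1.trans (mul_le_mul (s2 u) (s2 v) (Real.sqrt_nonneg _) (by positivity))
  have c2 := b2.trans (mul_le_mul (s3 u) (s3 v) (Real.sqrt_nonneg _) (by positivity))
  have c3 := b3.trans (mul_le_mul (s4 u) (s4 v) (Real.sqrt_nonneg _) (by positivity))
  have c4 : √(∫ x, (X.fn u x * X.fn v x) ^ 2) ≤ √M * (‖u‖ * ‖v‖) := by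
    rw [Real.sqrt_le_left (by positivity)]
    have e : ∫ x, (X.fn u x * X.fn v x) ^ 2 = ∫ x, 1 * |X.fn u x ^ 2 * X.fn v x ^ 2| := by
      congr 1; funext x
      rw [one_mul, abs_of_nonneg (by positivity), mul_pow]
    rw [e]
    refine c3.trans_eq ?_
    ring
  have e1 : √K * ‖u‖ * (√K * ‖v‖) = K * (‖u‖ * ‖v‖) := by
    rw [mul_mul_mul_comm, Real.mul_self_sqrt hK]
  rw [e1] at c1
  simp only [one_mul] at c1
  unfold logSize
  linarith

variable (hV) in
lemma X.exists_abs_B₀_mul_le : ∃ C : ℝ, 0 ≤ C ∧ ∀ a b c d : X hV,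
    |B₀ (fun x => X.fn a x * X.fn b x) (fun x => X.fn c x * X.fn d x)|
      ≤ C * ((‖a‖ * ‖b‖) * (‖c‖ * ‖d‖)) := by
  obtain ⟨C, hC, h⟩ := X.exists_logSize_mul_le hV
  have hs := singularConst_nonneg
  refine ⟨(1 + 2 * singularConst) * C ^ 2, by positivity, fun a b c d => ?_⟩
  refine (abs_B₀_le (a.logIntegrable_mul b) (c.logIntegrable_mul d)).trans ?_
  have := mul_le_mul (h a b) (h c d) (logSize_nonneg _) (by positivity)
  calc _ ≤ (1 + 2 * singularConst) * (C * (‖a‖ * ‖b‖) * (C * (‖c‖ * ‖d‖))) :=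
        mul_le_mul_of_nonneg_left this (by positivity)
    _ = _ := by ring

end Estimates

/-! ### Fréchet differentiability of the action -/

section Differentiability

variable {V : Plane → ℝ} {hV : PotentialAssumption V}

/-- The energy is the squared Hilbert norm minus the logarithmically weighted integral. The former
is differentiable in any inner product space, so only the bounded quadratic form of the weight has
to be expanded. -/
lemma X.differentiableAt_energy (u : X hV) : DifferentiableAt ℝ (X.energy (hV := hV)) u := by
  have hW : DifferentiableAt ℝ (fun u : X hV => ∫ x, logWeight x * X.fn u x ^ 2) u := by
    let L : X hV →ₗ[ℝ] ℝ :=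
      { toFun := fun h => 2 * ∫ x, logWeight x * (X.fn u x * X.fn h x)
        map_add' := fun h k => by
          rw [← mul_add, ← integral_add (u.integrable_logWeight_mul h)
            (u.integrable_logWeight_mul k)]
          congr 1
          refine integral_congr_ae ?_
          filter_upwards [X.fn_add h k] with x hx
          simp only [hx, Pi.add_apply]
          ring
        map_smul' := fun r h => by
          simp only [RingHom.id_apply, smul_eq_mul]
          rw [mul_left_comm, ← integral_const_mul r]
          congr 1
          refine integral_congr_ae ?_
          filter_upwards [X.fn_smul r h] with x hx
          simp only [hx, Pi.smul_apply, smul_eq_mul]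
          ring }
    refine differentiableAt_of_quadratic_remainder L (C := 2 * ‖u‖) (D := 1) ?_ ?_
    · intro h
      have b := integral_weight_abs_mul_le (μ := volume) logWeight_nonneg
        u.integrable_logWeight_sq h.integrable_logWeight_sq (u.integrable_logWeight_mul h)
      have s3 : ∀ u : X hV, √(∫ x, logWeight x * X.fn u x ^ 2) ≤ ‖u‖ := by
        intro u
        rw [Real.sqrt_le_left (by positivity)]
        exact u.integral_logWeight_sq_le_norm_sq
      have c := b.trans (mul_le_mul (s3 u) (s3 h) (Real.sqrt_nonneg _) (norm_nonneg _))
      have d : |∫ x, logWeight x * (X.fn u x * X.fn h x)|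
          ≤ ∫ x, logWeight x * |X.fn u x * X.fn h x| := by
        refine (abs_integral_le_integral_abs).trans_eq ?_
        congr 1; funext x
        rw [abs_mul, abs_of_nonneg (logWeight_nonneg x)]
      change |2 * ∫ x, logWeight x * (X.fn u x * X.fn h x)| ≤ _
      rw [abs_mul, abs_two]
      linarith
    · intro h _
      have e : ∫ x, logWeight x * X.fn (u + h) x ^ 2
          = (∫ x, logWeight x * X.fn u x ^ 2)
            + 2 * (∫ x, logWeight x * (X.fn u x * X.fn h x))
            + ∫ x, logWeight x * X.fn h x ^ 2 := by
        have i1 : Integrable (fun x => logWeight x * X.fn u x ^ 2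
            + 2 * (logWeight x * (X.fn u x * X.fn h x))) volume :=
          u.integrable_logWeight_sq.add ((u.integrable_logWeight_mul h).const_mul 2)
        rw [← integral_const_mul, ← integral_add u.integrable_logWeight_sq
          ((u.integrable_logWeight_mul h).const_mul 2), ← integral_add i1 h.integrable_logWeight_sq]
        refine integral_congr_ae ?_
        filter_upwards [X.fn_add u h] with x hx
        simp only [hx, Pi.add_apply]
        ring
      change |(∫ x, logWeight x * X.fn (u + h) x ^ 2) - (∫ x, logWeight x * X.fn u x ^ 2)
        - 2 * ∫ x, logWeight x * (X.fn u x * X.fn h x)| ≤ _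
      rw [e]
      ring_nf
      rw [abs_of_nonneg h.integral_logWeight_sq_nonneg]
      exact h.integral_logWeight_sq_le_norm_sq
  have hn : DifferentiableAt ℝ (fun u : X hV => ‖u‖ ^ 2) u :=
    differentiableAt_id.norm_sq ℝ
  have e : X.energy (hV := hV) = fun u => ‖u‖ ^ 2 - ∫ x, logWeight x * X.fn u x ^ 2 := by
    funext v
    rw [X.norm_sq_eq]
    ring
  rw [e]
  exact hn.sub hW

/-- Quartic expansion grouped by order in `h`: the linear term stands apart, and the parenthesis is
the remainder, of order at least two. -/
lemma X.V₀_add (u h : X hV) : V₀ (X.fn (u + h)) = V₀ (X.fn u)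
    + 4 * B₀ (fun x => X.fn u x * X.fn u x) (fun x => X.fn u x * X.fn h x)
    + (2 * B₀ (fun x => X.fn u x * X.fn u x) (fun x => X.fn h x * X.fn h x)
      + 4 * B₀ (fun x => X.fn u x * X.fn h x) (fun x => X.fn u x * X.fn h x)
      + 4 * B₀ (fun x => X.fn u x * X.fn h x) (fun x => X.fn h x * X.fn h x)
      + B₀ (fun x => X.fn h x * X.fn h x) (fun x => X.fn h x * X.fn h x)) := by
  have hae : (fun x => X.fn (u + h) x ^ 2) =ᵐ[volume]
      fun x => X.fn u x * X.fn u x + (2 * (X.fn u x * X.fn h x) + X.fn h x * X.fn h x) := by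
    filter_upwards [X.fn_add u h] with x hx
    simp only [hx, Pi.add_apply]
    ring
  have l1 := u.logIntegrable_mul u
  have l2 := (u.logIntegrable_mul h).const_mul 2
  have l3 := h.logIntegrable_mul h
  have l23 := l2.add l3
  have l := l1.add l23
  unfold V₀
  rw [B₀_congr hae hae, B₀_add_left l1 l23 l, B₀_add_left l2 l3 l, B₀_add_right l1 l1 l23,
    B₀_add_right l1 l2 l3, B₀_add_right l2 l1 l23, B₀_add_right l2 l2 l3, B₀_add_right l3 l1 l23,
    B₀_add_right l3 l2 l3]
  simp only [B₀_const_mul_left, B₀_const_mul_right, sq]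
  rw [B₀_symm (f := fun x => X.fn u x * X.fn h x) (g := fun x => X.fn u x * X.fn u x),
    B₀_symm (f := fun x => X.fn h x * X.fn h x) (g := fun x => X.fn u x * X.fn u x),
    B₀_symm (f := fun x => X.fn h x * X.fn h x) (g := fun x => X.fn u x * X.fn h x)]
  ring

lemma X.differentiableAt_V₀ (u : X hV) : DifferentiableAt ℝ (fun u : X hV => V₀ (X.fn u)) u := by
  obtain ⟨C, hC, hB⟩ := X.exists_abs_B₀_mul_le hV
  let L : X hV →ₗ[ℝ] ℝ :=
    { toFun := fun h => 4 * B₀ (fun x => X.fn u x * X.fn u x) (fun x => X.fn u x * X.fn h x)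
      map_add' := fun h k => by
        rw [← mul_add, ← B₀_add_right (u.logIntegrable_mul u) (u.logIntegrable_mul h)
          (u.logIntegrable_mul k)]
        congr 1
        refine B₀_congr EventuallyEq.rfl ?_
        filter_upwards [X.fn_add h k] with x hx
        simp only [hx, Pi.add_apply]
        ring
      map_smul' := fun r h => by
        simp only [RingHom.id_apply, smul_eq_mul]
        rw [mul_left_comm, ← B₀_const_mul_right (r := r)]
        congr 1
        refine B₀_congr EventuallyEq.rfl ?_
        filter_upwards [X.fn_smul r h] with x hx
        simp only [hx, Pi.smul_apply, smul_eq_mul]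
        ring }
  -- In `D`, `6 = 2 + 4` collects the two second-order terms; the cubic and quartic ones are reduced
  -- to order two by `‖h‖ ≤ 1`.
  refine differentiableAt_of_quadratic_remainder L (C := 4 * C * ‖u‖ ^ 3)
    (D := C * (6 * ‖u‖ ^ 2 + 4 * ‖u‖ + 1)) ?_ ?_
  · intro h
    change |4 * B₀ (fun x => X.fn u x * X.fn u x) (fun x => X.fn u x * X.fn h x)| ≤ _
    rw [abs_mul, abs_of_nonneg (show (0 : ℝ) ≤ 4 by norm_num)]
    linarith [hB u u u h]
  · intro h hh
    change |V₀ (X.fn (u + h)) - V₀ (X.fn u)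
      - 4 * B₀ (fun x => X.fn u x * X.fn u x) (fun x => X.fn u x * X.fn h x)| ≤ _
    rw [X.V₀_add, add_assoc, add_sub_cancel_left, add_sub_cancel_left]
    have n0 := norm_nonneg h
    have m0 := norm_nonneg u
    have h1 := abs_le.1 (hB u u h h)
    have h2 := abs_le.1 (hB u h u h)
    have h3 := abs_le.1 (hB u h h h)
    have h4 := abs_le.1 (hB h h h h)
    have k3 : C * (‖u‖ * ‖h‖ * (‖h‖ * ‖h‖)) ≤ C * (‖u‖ * ‖h‖ ^ 2) := by
      refine mul_le_mul_of_nonneg_left ?_ hC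
      calc ‖u‖ * ‖h‖ * (‖h‖ * ‖h‖) = ‖u‖ * ‖h‖ ^ 2 * ‖h‖ := by ring
        _ ≤ ‖u‖ * ‖h‖ ^ 2 := mul_le_of_le_one_right (by positivity) hh
    have k4 : C * (‖h‖ * ‖h‖ * (‖h‖ * ‖h‖)) ≤ C * ‖h‖ ^ 2 := by
      refine mul_le_mul_of_nonneg_left ?_ hC
      calc ‖h‖ * ‖h‖ * (‖h‖ * ‖h‖) = ‖h‖ ^ 2 * ‖h‖ ^ 2 := by ring
        _ ≤ ‖h‖ ^ 2 := mul_le_of_le_one_right (by positivity) (pow_le_one₀ n0 hh)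
    rw [abs_le]
    constructor <;> linarith

/-- Integrate the pointwise Taylor estimate. The linear term is bounded because `|u|^(p-1)` is in
`L²`; in the remainder, `|u|^(p-2)` and `h²` are both in `L²`, and `∫ |h|ᵖ` is at most quadratic in
`‖h‖` when `‖h‖ ≤ 1`. -/
lemma X.differentiableAt_integral_rpow {p : ℝ} (hp : 4 < p) (u : X hV) :
    DifferentiableAt ℝ (fun u : X hV => ∫ x, |X.fn u x| ^ p) u := by
  obtain ⟨k, hk⟩ := exists_nat_rpow_le p
  obtain ⟨C₂, hC₂, h2⟩ := X.exists_integral_pow_le_norm hV 0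
  obtain ⟨C₄, hC₄, h4⟩ := X.exists_integral_pow_le_norm hV 1
  obtain ⟨C, hC, hCk⟩ := X.exists_integral_pow_le_norm hV k
  have hmeas : ∀ q : ℝ, AEStronglyMeasurable (fun x => |X.fn u x| ^ q) (volume : Measure Plane) :=
    fun q => (u.memLp_fn.1.aemeasurable.abs.pow_const q).aestronglyMeasurable
  have hmF : AEStronglyMeasurable (fun x => p * |X.fn u x| ^ (p - 2) * X.fn u x)
      (volume : Measure Plane) := ((hmeas _).const_mul p).mul u.memLp_fn.1
  have hF2 : Integrable (fun x => (p * |X.fn u x| ^ (p - 2) * X.fn u x) ^ 2) volume := by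
    refine ((u.integrable_rpow (q := 2 * (p - 1)) (by linarith)).const_mul (p ^ 2)).congr
      (Eventually.of_forall fun x => ?_)
    simp only
    rcases eq_or_ne (X.fn u x) 0 with h0 | h0
    · rw [h0, abs_zero, Real.zero_rpow (by linarith), Real.zero_rpow (by linarith)]
      ring
    · have e : |X.fn u x| ^ (2 * (p - 1)) = (|X.fn u x| ^ (p - 2) * |X.fn u x|) ^ 2 := by
        rw [← Real.rpow_add_one (abs_ne_zero.2 h0), ← Real.rpow_mul_natCast (abs_nonneg _)]
        congr 1
        push_cast
        ring
      rw [e, mul_pow, mul_pow, mul_pow, sq_abs]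
      ring
  have hFm : MemLp (fun x => p * |X.fn u x| ^ (p - 2) * X.fn u x) 2 (volume : Measure Plane) :=
    (memLp_two_iff_integrable_sq hmF).2 hF2
  have hG2 : Integrable (fun x => (|X.fn u x| ^ (p - 2)) ^ 2) volume := by
    refine (u.integrable_rpow (q := (p - 2) * 2) (by linarith)).congr
      (Eventually.of_forall fun x => ?_)
    simp only
    rw [Real.rpow_mul (abs_nonneg _), Real.rpow_two]
  have hGm : MemLp (fun x => |X.fn u x| ^ (p - 2)) 2 (volume : Measure Plane) :=
    (memLp_two_iff_integrable_sq (hmeas _)).2 hG2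
  have hsqm : ∀ h : X hV, MemLp (fun x => X.fn h x ^ 2) 2 (volume : Measure Plane) := fun h =>
    (memLp_two_iff_integrable_sq (f := fun x => X.fn h x ^ 2) (h.memLp_fn.1.pow 2)).2
      (by simpa only [← pow_mul] using h.integrable_pow 1)
  have hLi : ∀ h : X hV, Integrable (fun x => p * |X.fn u x| ^ (p - 2) * X.fn u x * X.fn h x)
      volume := fun h => hFm.integrable_mul h.memLp_fn
  have hGi : ∀ h : X hV, Integrable (fun x => |X.fn u x| ^ (p - 2) * X.fn h x ^ 2) volume :=
    fun h => hGm.integrable_mul (hsqm h)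
  let L : X hV →ₗ[ℝ] ℝ :=
    { toFun := fun h => ∫ x, p * |X.fn u x| ^ (p - 2) * X.fn u x * X.fn h x
      map_add' := fun h k => by
        rw [← integral_add (hLi h) (hLi k)]
        refine integral_congr_ae ?_
        filter_upwards [X.fn_add h k] with x hx
        simp only [hx, Pi.add_apply]
        ring
      map_smul' := fun r h => by
        simp only [RingHom.id_apply, smul_eq_mul]
        rw [← integral_const_mul]
        refine integral_congr_ae ?_
        filter_upwards [X.fn_smul r h] with x hx
        simp only [hx, Pi.smul_apply, smul_eq_mul]
        ring }
  have hp1 : 0 ≤ p * (p - 1) := by nlinarith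
  refine differentiableAt_of_quadratic_remainder L
    (C := √(∫ x, (p * |X.fn u x| ^ (p - 2) * X.fn u x) ^ 2) * √C₂)
    (D := p * (p - 1) * 2 ^ (p - 2) * (√(∫ x, (|X.fn u x| ^ (p - 2)) ^ 2) * √C₄ + (C₂ + C))) ?_ ?_
  · intro h
    change |∫ x, p * |X.fn u x| ^ (p - 2) * X.fn u x * X.fn h x| ≤ _
    refine (abs_integral_mul_le hF2 h.integrable_sq (hLi h)).trans ?_
    rw [mul_assoc]
    refine mul_le_mul_of_nonneg_left ?_ (Real.sqrt_nonneg _)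
    rw [Real.sqrt_le_left (by positivity), mul_pow, Real.sq_sqrt hC₂]
    simpa using h2 h
  · intro h hh
    have hip := h.integrable_rpow (q := p) (by linarith)
    have hmaj : Integrable (fun x => p * (p - 1) * 2 ^ (p - 2)
        * (|X.fn u x| ^ (p - 2) * X.fn h x ^ 2 + |X.fn h x| ^ p)) volume :=
      ((hGi h).add hip).const_mul _
    have e : (∫ x, |X.fn (u + h) x| ^ p) - (∫ x, |X.fn u x| ^ p) - L h
        = ∫ x, (|X.fn u x + X.fn h x| ^ p - |X.fn u x| ^ p
          - p * |X.fn u x| ^ (p - 2) * X.fn u x * X.fn h x) := by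
      have i1 := (u + h).integrable_rpow (q := p) (by linarith)
      have i2 := u.integrable_rpow (q := p) (by linarith)
      change (∫ x, |X.fn (u + h) x| ^ p) - (∫ x, |X.fn u x| ^ p)
        - (∫ x, p * |X.fn u x| ^ (p - 2) * X.fn u x * X.fn h x) = _
      have i12 : Integrable (fun x => |X.fn (u + h) x| ^ p - |X.fn u x| ^ p) volume := i1.sub i2
      rw [← integral_sub i1 i2, ← integral_sub i12 (hLi h)]
      refine integral_congr_ae ?_
      filter_upwards [X.fn_add u h] with x hx
      simp only [hx, Pi.add_apply]
    rw [e]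
    have h5 := norm_integral_le_of_norm_le (f := fun x => |X.fn u x + X.fn h x| ^ p
      - |X.fn u x| ^ p - p * |X.fn u x| ^ (p - 2) * X.fn u x * X.fn h x) hmaj
      (Eventually.of_forall fun x => abs_rpow_taylor hp (X.fn u x) (X.fn h x))
    refine h5.trans ?_
    rw [integral_const_mul, integral_add (hGi h) hip, mul_assoc _ _ (‖h‖ ^ 2)]
    refine mul_le_mul_of_nonneg_left ?_ (by positivity)
    rw [add_mul]
    refine add_le_add ?_ ?_
    · refine (le_abs_self _).trans ((abs_integral_mul_le hG2
        (by simpa only [← pow_mul] using h.integrable_pow 1) (hGi h)).trans ?_)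
      rw [mul_assoc]
      refine mul_le_mul_of_nonneg_left ?_ (Real.sqrt_nonneg _)
      rw [Real.sqrt_le_left (by positivity), mul_pow, Real.sq_sqrt hC₄]
      simpa only [← pow_mul] using h4 h
    · refine (h.integral_rpow_le (by linarith) hk).trans ?_
      have a1 : ∫ x, X.fn h x ^ 2 ≤ C₂ * ‖h‖ ^ 2 := by simpa using h2 h
      have a2 : C * ‖h‖ ^ (2 * (k + 1)) ≤ C * ‖h‖ ^ 2 :=
        mul_le_mul_of_nonneg_left (pow_le_pow_of_le_one (norm_nonneg h) hh (by omega)) hC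
      linarith [hCk h]

variable (hV) in
lemma action_eq (p : ℝ) : action hV p = fun u => (1 / 2) * X.energy u + (1 / 4) * V₀ (X.fn u)
    - (1 / p) * ∫ x, |X.fn u x| ^ p := rfl

/-- `fderiv` is 0 wherever a function is not differentiable, so the Cerami condition carries
information only because of this. -/
lemma differentiableAt_action {p : ℝ} (hp : 4 < p) (u : X hV) :
    DifferentiableAt ℝ (action hV p) u := by
  rw [action_eq]
  exact ((u.differentiableAt_energy.const_mul _).add (u.differentiableAt_V₀.const_mul _)).sub
    ((X.differentiableAt_integral_rpow hp u).const_mul _)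

lemma X.energy_smul (t : ℝ) (u : X hV) : X.energy (t • u) = t ^ 2 * X.energy u := by
  unfold X.energy
  rw [← integral_const_mul]
  refine integral_congr_ae ?_
  filter_upwards [X.fn_smul t u, X.grad_smul t u] with x h1 h2
  simp only [h1, h2, Pi.smul_apply, smul_eq_mul, norm_smul, Real.norm_eq_abs, mul_pow, sq_abs]
  ring

lemma X.V₀_smul (t : ℝ) (u : X hV) : V₀ (X.fn (t • u)) = t ^ 4 * V₀ (X.fn u) := by
  have hae : (fun x => X.fn (t • u) x ^ 2) =ᵐ[volume] fun x => t ^ 2 * X.fn u x ^ 2 := by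
    filter_upwards [X.fn_smul t u] with x hx
    simp only [hx, Pi.smul_apply, smul_eq_mul, mul_pow]
  unfold V₀
  rw [B₀_congr hae hae, B₀_const_mul_left, B₀_const_mul_right]
  ring

lemma X.integral_rpow_smul (p : ℝ) {t : ℝ} (ht : 0 ≤ t) (u : X hV) :
    ∫ x, |X.fn (t • u) x| ^ p = t ^ p * ∫ x, |X.fn u x| ^ p := by
  rw [← integral_const_mul]
  refine integral_congr_ae ?_
  filter_upwards [X.fn_smul t u] with x hx
  simp only [hx, Pi.smul_apply, smul_eq_mul, abs_mul, abs_of_nonneg ht]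
  exact Real.mul_rpow ht (abs_nonneg _)

/-- The derivative of the action at `u` in the direction `u` is `∫ (|∇u|² + V u²) + V₀(u) - ∫ |u|ᵖ`. -/
lemma fderiv_action_self {p : ℝ} (hp : 4 < p) (u : X hV) :
    fderiv ℝ (action hV p) u u = X.energy u + V₀ (X.fn u) - ∫ x, |X.fn u x| ^ p := by
  -- Differentiating along the ray `t • u` at `t = 1` suffices: by homogeneity of degrees 2, 4 and
  -- `p`, the action there is an explicit function of `t > 0`.
  have hd : HasDerivAt (fun t : ℝ => action hV p (t • u)) (fderiv ℝ (action hV p) u u) 1 := by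
    have h1 : HasFDerivAt (action hV p) (fderiv ℝ (action hV p) u) ((1 : ℝ) • u) := by
      rw [one_smul]
      exact (differentiableAt_action hp u).hasFDerivAt
    have h2 : HasDerivAt (fun t : ℝ => t • u) u 1 := by
      simpa using (hasDerivAt_id (1 : ℝ)).smul_const u
    exact h1.comp_hasDerivAt (1 : ℝ) h2
  have hd2 : HasDerivAt (fun t : ℝ => (1 / 2) * (t ^ 2 * X.energy u)
      + (1 / 4) * (t ^ 4 * V₀ (X.fn u)) - (1 / p) * (t ^ p * ∫ x, |X.fn u x| ^ p))
      (X.energy u + V₀ (X.fn u) - ∫ x, |X.fn u x| ^ p) 1 := by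
    have a := ((hasDerivAt_pow 2 (1 : ℝ)).mul_const (X.energy u)).const_mul (1 / 2)
    have b := ((hasDerivAt_pow 4 (1 : ℝ)).mul_const (V₀ (X.fn u))).const_mul (1 / 4)
    have c := ((Real.hasDerivAt_rpow_const (x := 1) (p := p) (Or.inl one_ne_zero)).mul_const
      (∫ x, |X.fn u x| ^ p)).const_mul (1 / p)
    refine ((a.add b).sub c).congr_deriv ?_
    have : p ≠ 0 := by linarith
    rw [Real.one_rpow]
    field_simp
    norm_num
    ring
  refine hd.unique (hd2.congr_of_eventuallyEq ?_)
  filter_upwards [lt_mem_nhds (show (0 : ℝ) < 1 from one_pos)] with t ht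
  simp only [action_eq, X.energy_smul, X.V₀_smul, X.integral_rpow_smul p ht.le]

end Differentiability

lemma B₁_nonneg {f g : Plane → ℝ} (hf : ∀ x, 0 ≤ f x) (hg : ∀ x, 0 ≤ g x) : 0 ≤ B₁ f g :=
  integral_nonneg fun z => mul_nonneg (mul_nonneg (logWeight_nonneg (z.1 - z.2)) (hf _)) (hg _)

/-! ### Uniform tails, vanishing, and control of the weighted norm -/

section Compactness

variable {V : Plane → ℝ} {hV : PotentialAssumption V}

variable (hV) in
/-- Functions of bounded energy have uniformly small tails in `L²`. -/
lemma X.exists_setIntegral_compl_ball_le (M : ℝ) {ε : ℝ} (hε : 0 < ε) : ∃ R : ℝ, ∀ u : X hV,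
    X.energy u ≤ M → ∫ x in (Metric.ball 0 R)ᶜ, X.fn u x ^ 2 ≤ ε := by
  obtain ⟨K, hK, h2⟩ := X.exists_integral_sq_le_energy hV
  obtain ⟨C, hC, h4⟩ := X.exists_integral_pow_le hV 1
  set M' := |M| + 1 with hM'
  have hM0 : 0 < M' := by positivity
  set Q := C * (K * M') * M' + 1 with hQ
  have hQ0 : 0 < Q := by positivity
  -- Each of three contributions is to be at most `ε / 3`. Where `V > N`, `u² ≤ V u² / N`; on the
  -- sublevel set, `u² ≤ u⁴ / t + t`, where `Q` bounds `∫ u⁴` and the constant `t` is integrated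
  -- over a set of small measure outside a large ball.
  set N := 3 * M' / ε with hN
  have hN0 : 0 < N := by positivity
  set t := 3 * Q / ε with ht
  have ht0 : 0 < t := by positivity
  -- `V` is known to be measurable only up to null sets, so a measurable hull of the same measure
  -- replaces the sublevel set.
  set T := toMeasurable volume {x | V x ≤ N} with hT
  have hTm : MeasurableSet T := measurableSet_toMeasurable _ _
  have hTfin : volume T ≠ ⊤ := by
    rw [hT, measure_toMeasurable]
    exact (hV.sublevel_finite N hN0).ne
  have hlim : Tendsto (fun n : ℕ => volume (T \ Metric.ball 0 (n : ℝ))) atTop (𝓝 0) := by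
    have h := tendsto_measure_iInter_atTop (μ := (volume : Measure Plane))
      (s := fun n : ℕ => T \ Metric.ball 0 (n : ℝ))
      (fun n => (hTm.diff measurableSet_ball).nullMeasurableSet)
      (fun m n hmn => Set.sdiff_subset_sdiff_right (Metric.ball_subset_ball (by exact_mod_cast hmn)))
      ⟨0, measure_ne_top_of_subset Set.sdiff_subset hTfin⟩
    have e : ⋂ n : ℕ, T \ Metric.ball (0 : Plane) (n : ℝ) = ∅ := by
      refine Set.eq_empty_of_forall_notMem fun x hx => ?_
      obtain ⟨n, hn⟩ := exists_nat_gt ‖x‖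
      exact (Set.mem_iInter.1 hx n).2 (by simpa using hn)
    rwa [e, measure_empty] at h
  obtain ⟨n, hn⟩ := ((ENNReal.tendsto_nhds_zero.1 hlim) (ENNReal.ofReal (ε / (3 * t)))
    (ENNReal.ofReal_pos.2 (by positivity))).exists
  have hnr : volume.real (T \ Metric.ball 0 (n : ℝ)) ≤ ε / (3 * t) :=
    ENNReal.toReal_le_of_le_ofReal (by positivity) hn
  refine ⟨n, fun u hu => ?_⟩
  have hu' : X.energy u ≤ M' := hu.trans ((le_abs_self M).trans (by linarith))
  have hE0 := u.energy_nonneg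
  have i4 : Integrable (fun x => X.fn u x ^ 4) volume := u.integrable_pow 1
  have b4 : ∫ x, X.fn u x ^ 4 ≤ Q := by
    have h := (h4 u).2
    simp only [Nat.reduceAdd, Nat.reduceMul, pow_one] at h
    have h3 := h2 u
    calc ∫ x, X.fn u x ^ 4 ≤ C * (∫ x, X.fn u x ^ 2) * X.energy u := h
      _ ≤ C * (K * M') * M' := by
        have : ∫ x, X.fn u x ^ 2 ≤ K * M' := h3.trans (mul_le_mul_of_nonneg_left hu' hK)
        gcongr
      _ ≤ Q := by linarith
  have bV : ∫ x, V x * X.fn u x ^ 2 ≤ M' := by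
    have := X.energy_eq u
    linarith [u.integral_grad_sq_nonneg]
  set Bc : Set Plane := (Metric.ball 0 (n : ℝ))ᶜ with hBc
  have hBm : MeasurableSet Bc := measurableSet_ball.compl
  have iT : Integrable (T.indicator fun _ => t) (volume : Measure Plane) :=
    (integrable_indicator_iff hTm).2 (integrableOn_const hTfin)
  have i1 := u.integrable_potential_sq.const_mul N⁻¹
  have i2 := i4.const_mul t⁻¹
  have hpt : ∀ x, X.fn u x ^ 2 ≤ N⁻¹ * (V x * X.fn u x ^ 2) + t⁻¹ * X.fn u x ^ 4
      + T.indicator (fun _ => t) x := by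
    intro x
    have p1 : 0 ≤ N⁻¹ * (V x * X.fn u x ^ 2) :=
      mul_nonneg (by positivity) (mul_nonneg (hV.pos x).le (sq_nonneg _))
    have p2 : 0 ≤ t⁻¹ * X.fn u x ^ 4 := by positivity
    have p3 : 0 ≤ T.indicator (fun _ => t) x := Set.indicator_nonneg (fun _ _ => ht0.le) _
    by_cases hx : V x ≤ N
    · have hxT : x ∈ T := subset_toMeasurable _ _ hx
      rw [Set.indicator_of_mem hxT]
      have : X.fn u x ^ 2 ≤ t⁻¹ * X.fn u x ^ 4 + t := by
        rw [inv_mul_eq_div, div_add' _ _ _ ht0.ne', le_div_iff₀ ht0]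
        nlinarith [sq_nonneg (X.fn u x ^ 2 - t), sq_nonneg (X.fn u x ^ 2)]
      linarith
    · push Not at hx
      have : X.fn u x ^ 2 ≤ N⁻¹ * (V x * X.fn u x ^ 2) := by
        rw [le_inv_mul_iff₀ hN0]
        exact mul_le_mul_of_nonneg_right hx.le (sq_nonneg _)
      linarith
  have i12 : Integrable (fun x => N⁻¹ * (V x * X.fn u x ^ 2) + t⁻¹ * X.fn u x ^ 4) volume :=
    i1.add i2
  have hmono : ∫ x in Bc, X.fn u x ^ 2 ≤ ∫ x in Bc, (N⁻¹ * (V x * X.fn u x ^ 2)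
      + t⁻¹ * X.fn u x ^ 4 + T.indicator (fun _ => t) x) :=
    integral_mono u.integrable_sq.integrableOn (i12.add iT).integrableOn hpt
  rw [integral_add i12.integrableOn iT.integrableOn] at hmono
  have s1 : ∫ x in Bc, (N⁻¹ * (V x * X.fn u x ^ 2) + t⁻¹ * X.fn u x ^ 4)
      ≤ ∫ x, (N⁻¹ * (V x * X.fn u x ^ 2) + t⁻¹ * X.fn u x ^ 4) := by
    refine setIntegral_le_integral i12 (Eventually.of_forall fun x => ?_)
    have p1 : 0 ≤ N⁻¹ * (V x * X.fn u x ^ 2) :=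
      mul_nonneg (by positivity) (mul_nonneg (hV.pos x).le (sq_nonneg _))
    have p2 : 0 ≤ t⁻¹ * X.fn u x ^ 4 := by positivity
    exact add_nonneg p1 p2
  rw [integral_add i1 i2, integral_const_mul, integral_const_mul] at s1
  have s2 : ∫ x in Bc, T.indicator (fun _ => t) x ≤ ε / 3 := by
    rw [setIntegral_indicator hTm, setIntegral_const, smul_eq_mul]
    have e : Bc ∩ T = T \ Metric.ball 0 (n : ℝ) := by
      rw [hBc, Set.inter_comm]; rfl
    rw [e]
    calc volume.real (T \ Metric.ball 0 (n : ℝ)) * t ≤ ε / (3 * t) * t := by gcongr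
      _ = ε / 3 := by field_simp
  have s3 : N⁻¹ * ∫ x, V x * X.fn u x ^ 2 ≤ ε / 3 := by
    calc N⁻¹ * ∫ x, V x * X.fn u x ^ 2 ≤ N⁻¹ * M' := by gcongr
      _ = ε / 3 := by rw [hN]; field_simp
  have s4 : t⁻¹ * ∫ x, X.fn u x ^ 4 ≤ ε / 3 := by
    calc t⁻¹ * ∫ x, X.fn u x ^ 4 ≤ t⁻¹ * Q := by gcongr
      _ = ε / 3 := by rw [ht]; field_simp
  linarith

/-- A sequence of bounded energy that vanishes on every ball of radius `2` tends to `0` in `L²`. -/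
lemma X.tendsto_integral_sq_of_tendsto_ball {u : ℕ → X hV} {M : ℝ} (hM : ∀ n, X.energy (u n) ≤ M)
    (hu : ∀ y : Plane, Tendsto (fun n => ∫ x in Metric.ball y 2, X.fn (u n) x ^ 2) atTop (𝓝 0)) :
    Tendsto (fun n => ∫ x, X.fn (u n) x ^ 2) atTop (𝓝 0) := by
  rw [Metric.tendsto_atTop']
  intro ε hε
  obtain ⟨R, hR⟩ := X.exists_setIntegral_compl_ball_le hV M (half_pos hε)
  -- The tail outside radius `R` is small uniformly in `n`; inside, finitely many balls of radius 2
  -- suffice, each with vanishing mass.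
  obtain ⟨s, -, hsfin, hs⟩ := (isCompact_closedBall (0 : Plane) R).finite_cover_balls
    (show (0 : ℝ) < 2 by norm_num)
  have hsum : Tendsto (fun n => ∑ y ∈ hsfin.toFinset, ∫ x in Metric.ball y 2, X.fn (u n) x ^ 2)
      atTop (𝓝 0) := by
    have := tendsto_finsetSum hsfin.toFinset fun y _ => hu y
    simpa using this
  obtain ⟨n₀, hn₀⟩ := eventually_atTop.1 (hsum.eventually (gt_mem_nhds (half_pos hε)))
  refine ⟨n₀, fun n hn => ?_⟩
  have hb := hn₀ n hn.le
  have hc := hR (u n) (hM n)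
  have hi := (u n).integrable_sq
  have hball : ∫ x in Metric.ball 0 R, X.fn (u n) x ^ 2
      ≤ ∑ y ∈ hsfin.toFinset, ∫ x in Metric.ball y 2, X.fn (u n) x ^ 2 := by
    simp only [← integral_indicator (measurableSet_ball (α := Plane))]
    rw [← integral_finsetSum _ fun y _ => hi.indicator measurableSet_ball]
    refine integral_mono (hi.indicator measurableSet_ball)
      (integrable_finsetSum _ fun y _ => hi.indicator measurableSet_ball) fun x => ?_
    have hnn : ∀ y : Plane, 0 ≤ (Metric.ball y 2).indicator (fun x => X.fn (u n) x ^ 2) x :=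
      fun y => Set.indicator_nonneg (fun _ _ => sq_nonneg _) _
    by_cases hx : x ∈ Metric.ball (0 : Plane) R
    · obtain ⟨y, hy, hxy⟩ := Set.mem_iUnion₂.1 (hs (Metric.ball_subset_closedBall hx))
      rw [Set.indicator_of_mem hx]
      refine le_trans ?_ (Finset.single_le_sum (fun y _ => hnn y) (hsfin.mem_toFinset.2 hy))
      rw [Set.indicator_of_mem hxy]
    · rw [Set.indicator_of_notMem hx]
      exact Finset.sum_nonneg fun y _ => hnn y
  have hsplit := integral_add_compl (measurableSet_ball (x := (0 : Plane)) (ε := R)) hi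
  rw [Real.dist_eq, sub_zero, abs_of_nonneg (u n).integral_sq_nonneg]
  linarith

lemma X.abs_B₂_sq_le (u : X hV) :
    |B₂ (fun x => X.fn u x ^ 2) (fun x => X.fn u x ^ 2)|
      ≤ singularConst * ((∫ x, X.fn u x ^ 2) ^ 2 + ∫ x, X.fn u x ^ 4) := by
  have h := (integrable_and_abs_B₂_le u.logIntegrable_sq u.logIntegrable_sq).2
  have e : ∀ x, (X.fn u x ^ 2) ^ 2 = X.fn u x ^ 4 := fun x => by ring
  simp only [abs_of_nonneg (sq_nonneg (X.fn u _)), e] at h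
  rw [Real.mul_self_sqrt (integral_nonneg fun x => by positivity), ← sq] at h
  exact h

/-- Mass on a fixed ball turns a bound of `B₁(u², u²)` into a bound of the weighted norm. -/
lemma X.setIntegral_mul_weighted_le_B₁ (u : X hV) (y : Plane) :
    (∫ x in Metric.ball y 2, X.fn u x ^ 2) * ((∫ x, logWeight x * X.fn u x ^ 2)
      - Real.log (1 + (‖y‖ + 2)) * ∫ x, X.fn u x ^ 2)
      ≤ B₁ (fun x => X.fn u x ^ 2) (fun x => X.fn u x ^ 2) := by
  set ℓ := Real.log (1 + (‖y‖ + 2)) with hℓ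
  have hi := u.integrable_sq
  have i1 : Integrable (fun x => logWeight x * X.fn u x ^ 2 - ℓ * X.fn u x ^ 2) volume :=
    u.integrable_logWeight_sq.sub (hi.const_mul ℓ)
  have i2 : Integrable ((Metric.ball y 2).indicator fun x => X.fn u x ^ 2) volume :=
    hi.indicator measurableSet_ball
  -- The left side is the integral of a product function which lies pointwise below the integrand of
  -- `B₁`: on the ball by the logarithmic inequality, off it because the integrand is nonnegative.
  have e := integral_prod_mul (μ := volume) (ν := volume)
    (fun x => logWeight x * X.fn u x ^ 2 - ℓ * X.fn u x ^ 2)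
    ((Metric.ball y 2).indicator fun x => X.fn u x ^ 2)
  rw [integral_sub u.integrable_logWeight_sq (hi.const_mul ℓ), integral_const_mul,
    integral_indicator measurableSet_ball, mul_comm] at e
  rw [← e]
  refine integral_mono (i1.mul_prod i2)
    (integrable_and_abs_B₁_le u.logIntegrable_sq u.logIntegrable_sq).1 fun z => ?_
  have h0 : 0 ≤ Real.log (1 + ‖z.1 - z.2‖) := logWeight_nonneg _
  by_cases hz : z.2 ∈ Metric.ball y 2
  · simp only [Set.indicator_of_mem hz]
    rw [← sub_mul]
    refine mul_le_mul_of_nonneg_right (mul_le_mul_of_nonneg_right ?_ (sq_nonneg _)) (sq_nonneg _)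
    -- Writing `x = (x - y) - (-y)` gives `log(1+|x|) ≤ log(1+|x-y|) + log(1+|y|)`.
    have h1 := log_one_add_norm_sub_le (z.1 - z.2) (-z.2)
    have h2 : logWeight (-z.2) ≤ ℓ := by
      unfold logWeight
      refine Real.log_le_log (by positivity) ?_
      have h3 := norm_sub_norm_le z.2 y
      rw [Metric.mem_ball, dist_eq_norm] at hz
      rw [norm_neg]
      linarith
    rw [sub_neg_eq_add, sub_add_cancel] at h1
    change logWeight z.1 ≤ Real.log (1 + ‖z.1 - z.2‖) + _ at h1
    linarith
  · simp only [Set.indicator_of_notMem hz, mul_zero]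
    positivity

end Compactness

/-! ### Cerami sequences -/

section Cerami

lemma IsCeramiSeq.comp_strictMono {E : Type*} [NormedAddCommGroup E] [NormedSpace ℝ E] {J : E → ℝ}
    {c : ℝ} {x : ℕ → E} (hx : IsCeramiSeq J c x) {k : ℕ → ℕ} (hk : StrictMono k) :
    IsCeramiSeq J c (x ∘ k) :=
  ⟨hx.1.comp hk.tendsto_atTop, hx.2.comp hk.tendsto_atTop⟩

/-- The factor `1 + ‖x n‖` allows the derivative to be tested on `x n` itself before boundedness is
known. -/
lemma IsCeramiSeq.tendsto_fderiv_self {E : Type*} [NormedAddCommGroup E] [NormedSpace ℝ E]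
    {J : E → ℝ} {c : ℝ} {x : ℕ → E} (hx : IsCeramiSeq J c x) :
    Tendsto (fun n => fderiv ℝ J (x n) (x n)) atTop (𝓝 0) := by
  refine squeeze_zero_norm (fun n => ?_) hx.2
  refine ((fderiv ℝ J (x n)).le_opNorm (x n)).trans ?_
  exact mul_le_mul_of_nonneg_left (by linarith) (norm_nonneg _)

variable {V : Plane → ℝ} {hV : PotentialAssumption V} {p c : ℝ} {u : ℕ → X hV}

/-- In `I(u) - I'(u)u/4` the term `V₀` cancels, and `1/p ≤ 1/4` lets the power term be dropped. -/
lemma IsCeramiSeq.exists_energy_le (hp : 4 < p) (hu : IsCeramiSeq (action hV p) c u) :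
    ∃ M : ℝ, 0 ≤ M ∧ ∀ n, X.energy (u n) ≤ M := by
  have h := hu.1.sub (hu.tendsto_fderiv_self.const_mul (1 / 4))
  obtain ⟨B, hB⟩ := h.bddAbove_range
  have hle : ∀ n, X.energy (u n) ≤ 4 * B := by
    intro n
    have h1 := hB (Set.mem_range_self n)
    simp only [fderiv_action_self hp] at h1
    simp only [action_eq] at h1
    have hP : 0 ≤ ∫ x, |X.fn (u n) x| ^ p := integral_nonneg fun x => by positivity
    have hpp : 1 / p ≤ 1 / 4 := one_div_le_one_div_of_le (by norm_num) hp.le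
    nlinarith [mul_nonneg (sub_nonneg.2 hpp) hP]
  exact ⟨4 * B, (u 0).energy_nonneg.trans (hle 0), hle⟩

lemma V₀_eq (f : Plane → ℝ) : V₀ f = B₁ (fun x => f x ^ 2) (fun x => f x ^ 2)
    - B₂ (fun x => f x ^ 2) (fun x => f x ^ 2) := rfl

/-- A Cerami sequence at a positive level does not vanish on all balls of radius `2`. -/
lemma IsCeramiSeq.exists_ball (hp : 4 < p) (hc : 0 < c) (hu : IsCeramiSeq (action hV p) c u) :
    ∃ (y : Plane) (d : ℝ), 0 < d ∧ ∃ k : ℕ → ℕ, StrictMono k ∧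
      ∀ n, d ≤ ∫ x in Metric.ball y 2, X.fn (u (k n)) x ^ 2 := by
  by_contra hcon
  obtain ⟨M, hM0, hM⟩ := hu.exists_energy_le hp
  have hball : ∀ y : Plane,
      Tendsto (fun n => ∫ x in Metric.ball y 2, X.fn (u n) x ^ 2) atTop (𝓝 0) := by
    intro y
    refine tendsto_order.2 ⟨fun a ha => Eventually.of_forall fun n =>
      ha.trans_le (integral_nonneg fun x => sq_nonneg _), fun d hd => ?_⟩
    by_contra hev
    have hfr : ∃ᶠ n in atTop, d ≤ ∫ x in Metric.ball y 2, X.fn (u n) x ^ 2 := by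
      rw [not_eventually] at hev
      exact hev.mono fun n hn => not_lt.1 hn
    obtain ⟨k, hk, hkd⟩ := extraction_of_frequently_atTop hfr
    exact hcon ⟨y, d, hd, k, hk, hkd⟩
  have hL2 := X.tendsto_integral_sq_of_tendsto_ball hM hball
  -- The factor `∫ u²` in the Gagliardo–Nirenberg bound carries the decay; the energy factor only
  -- stays bounded.
  have hpow : ∀ k : ℕ, Tendsto (fun n => ∫ x, X.fn (u n) x ^ (2 * (k + 1))) atTop (𝓝 0) := by
    intro k
    obtain ⟨C, hC, hS⟩ := X.exists_integral_pow_le hV k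
    have hlim : Tendsto (fun n => C * (∫ x, X.fn (u n) x ^ 2) * M ^ k) atTop (𝓝 0) := by
      simpa using (hL2.const_mul C).mul_const (M ^ k)
    refine squeeze_zero (fun n => integral_nonneg fun x => (even_two_mul _).pow_nonneg _)
      (fun n => (hS (u n)).2.trans ?_) hlim
    have h1 := (u n).integral_sq_nonneg
    have h2 := (u n).energy_nonneg
    have h3 := hM n
    gcongr
  have hP : Tendsto (fun n => ∫ x, |X.fn (u n) x| ^ p) atTop (𝓝 0) := by
    obtain ⟨k, hk⟩ := exists_nat_rpow_le p
    refine squeeze_zero (fun n => integral_nonneg fun x => by positivity)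
      (fun n => (u n).integral_rpow_le (by linarith) hk) ?_
    simpa using hL2.add (hpow k)
  have hB₂ : Tendsto (fun n => B₂ (fun x => X.fn (u n) x ^ 2) (fun x => X.fn (u n) x ^ 2))
      atTop (𝓝 0) := by
    refine squeeze_zero_norm (fun n => (u n).abs_B₂_sq_le) ?_
    simpa using ((hL2.pow 2).add (hpow 1)).const_mul singularConst
  have hsum : Tendsto (fun n => X.energy (u n)
      + B₁ (fun x => X.fn (u n) x ^ 2) (fun x => X.fn (u n) x ^ 2)) atTop (𝓝 0) := by
    have h := (hu.tendsto_fderiv_self.add hB₂).add hP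
    simp only [add_zero] at h
    refine h.congr fun n => ?_
    rw [fderiv_action_self hp, V₀_eq]
    ring
  -- Energy and `B₁` are nonnegative, so the combination occurring in the action is squeezed between
  -- 0 and their sum.
  have hpart : Tendsto (fun n => (1 / 2) * X.energy (u n)
      + (1 / 4) * B₁ (fun x => X.fn (u n) x ^ 2) (fun x => X.fn (u n) x ^ 2)) atTop (𝓝 0) := by
    refine squeeze_zero (fun n => ?_) (fun n => ?_) hsum
    all_goals
      have h1 := (u n).energy_nonneg
      have h2 := B₁_nonneg (f := fun x => X.fn (u n) x ^ 2) (g := fun x => X.fn (u n) x ^ 2)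
        (fun x => sq_nonneg _) (fun x => sq_nonneg _)
      linarith
  have hact : Tendsto (fun n => action hV p (u n)) atTop (𝓝 0) := by
    have h := (hpart.sub (hB₂.const_mul (1 / 4))).sub (hP.const_mul (1 / p))
    simp only [mul_zero, sub_zero] at h
    refine h.congr fun n => ?_
    simp only [action_eq, V₀_eq]
    ring
  exact hc.ne' (tendsto_nhds_unique hu.1 hact)

/-- In `I'(u)u = energy + B₁ - B₂ - ∫ |u|ᵖ` the left side is bounded, and `B₂` and the power term
are controlled by the energy alone. -/
lemma IsCeramiSeq.exists_B₁_le (hp : 4 < p) (hu : IsCeramiSeq (action hV p) c u) :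
    ∃ Q : ℝ, 0 ≤ Q ∧ ∀ n, B₁ (fun x => X.fn (u n) x ^ 2) (fun x => X.fn (u n) x ^ 2) ≤ Q := by
  obtain ⟨M, hM0, hM⟩ := hu.exists_energy_le hp
  obtain ⟨K, hK, h2⟩ := X.exists_integral_sq_le_energy hV
  obtain ⟨k, hk⟩ := exists_nat_rpow_le p
  have hsq : ∀ n, ∫ x, X.fn (u n) x ^ 2 ≤ K * M := fun n =>
    (h2 (u n)).trans (mul_le_mul_of_nonneg_left (hM n) hK)
  have hpow : ∀ k : ℕ, ∃ C : ℝ, ∀ n, ∫ x, X.fn (u n) x ^ (2 * (k + 1)) ≤ C := by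
    intro k
    obtain ⟨C, hC, hS⟩ := X.exists_integral_pow_le hV k
    refine ⟨C * (K * M) * M ^ k, fun n => (hS (u n)).2.trans ?_⟩
    have h2 := (u n).energy_nonneg
    have h3 := hM n
    have h4 := hsq n
    gcongr
  obtain ⟨C₄, h4⟩ := hpow 1
  obtain ⟨Cp, hCp⟩ := hpow k
  obtain ⟨B, hB⟩ := hu.tendsto_fderiv_self.bddAbove_range
  have hs := singularConst_nonneg
  have hle : ∀ n, B₁ (fun x => X.fn (u n) x ^ 2) (fun x => X.fn (u n) x ^ 2)
      ≤ B + singularConst * ((K * M) ^ 2 + C₄) + (K * M + Cp) := by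
    intro n
    have h1 := hB (Set.mem_range_self n)
    simp only [fderiv_action_self hp, V₀_eq] at h1
    have h5 : |B₂ (fun x => X.fn (u n) x ^ 2) (fun x => X.fn (u n) x ^ 2)|
        ≤ singularConst * ((K * M) ^ 2 + C₄) := by
      refine (u n).abs_B₂_sq_le.trans ?_
      have := pow_le_pow_left₀ (u n).integral_sq_nonneg (hsq n) 2
      exact mul_le_mul_of_nonneg_left (add_le_add this (h4 n)) hs
    have h6 := (u n).integral_rpow_le (q := p) (by linarith) hk
    linarith [(le_abs_self _).trans h5, hsq n, hCp n, (u n).energy_nonneg]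
  refine ⟨_, ?_, hle⟩
  exact (B₁_nonneg (fun x => sq_nonneg _) (fun x => sq_nonneg _)).trans (hle 0)

/-- Cerami sequences at a positive level are bounded. -/
lemma IsCeramiSeq.exists_norm_le (hp : 4 < p) (hc : 0 < c) (hu : IsCeramiSeq (action hV p) c u) :
    ∃ C : ℝ, ∀ n, ‖u n‖ ≤ C := by
  by_contra hcon
  have hfr : ∀ m : ℕ, ∃ᶠ n in atTop, (m : ℝ) < ‖u n‖ := by
    intro m hev
    have hb : IsBoundedUnder (· ≤ ·) atTop fun n => ‖u n‖ :=
      ⟨m, eventually_map.2 (hev.mono fun n hn => not_lt.1 hn)⟩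
    obtain ⟨C, hC⟩ := hb.bddAbove_range
    exact hcon ⟨C, fun n => hC (Set.mem_range_self n)⟩
  obtain ⟨k, hk, hkn⟩ := extraction_forall_of_frequently hfr
  -- Nonvanishing is applied to the subsequence of diverging norms, itself a Cerami sequence, so
  -- that the ball keeps mass where the norms blow up.
  obtain ⟨y, d, hd, j, hj, hjd⟩ := (hu.comp_strictMono hk).exists_ball hp hc
  obtain ⟨M, hM0, hM⟩ := hu.exists_energy_le hp
  obtain ⟨Q, hQ0, hQ⟩ := hu.exists_B₁_le hp
  obtain ⟨K, hK, h2⟩ := X.exists_integral_sq_le_energy hV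
  set ℓ := Real.log (1 + (‖y‖ + 2))
  have hℓ : 0 ≤ ℓ := Real.log_nonneg (by linarith [norm_nonneg y])
  set W := Q / d + ℓ * (K * M)
  have hbound : ∀ n, ‖u (k (j n))‖ ^ 2 ≤ M + W := by
    intro n
    set v := u (k (j n)) with hv
    have hdv : d ≤ ∫ x in Metric.ball y 2, X.fn v x ^ 2 := hjd n
    have hmass : ℓ * ∫ x, X.fn v x ^ 2 ≤ ℓ * (K * M) :=
      mul_le_mul_of_nonneg_left ((h2 v).trans (mul_le_mul_of_nonneg_left (hM _) hK)) hℓ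
    have hB := (v.setIntegral_mul_weighted_le_B₁ y).trans (hQ _)
    have hw : ∫ x, logWeight x * X.fn v x ^ 2 ≤ W := by
      by_contra hlt
      push Not at hlt
      have hgt : Q / d < (∫ x, logWeight x * X.fn v x ^ 2) - ℓ * ∫ x, X.fn v x ^ 2 := by
        simp only [W] at hlt
        linarith
      have h0 : 0 ≤ Q / d := by positivity
      have h1 : d * (Q / d) < (∫ x in Metric.ball y 2, X.fn v x ^ 2)
          * ((∫ x, logWeight x * X.fn v x ^ 2) - ℓ * ∫ x, X.fn v x ^ 2) :=
        mul_lt_mul' hdv hgt h0 (hd.trans_le hdv)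
      rw [mul_div_cancel₀ _ hd.ne'] at h1
      linarith
    rw [X.norm_sq_eq]
    linarith [hM (k (j n))]
  -- The extra 1 makes `‖u (k (j n))‖ > n > 1`, so its square exceeds `M + W`.
  obtain ⟨n, hn⟩ := exists_nat_gt (M + W + 1)
  have h1 := hkn (j n)
  have h3 : (n : ℝ) ≤ (j n : ℝ) := by exact_mod_cast hj.id_le n
  have h4 := hbound n
  have hMW : 0 ≤ M + W := (sq_nonneg _).trans h4
  nlinarith

end Cerami

end SchrodingerPoisson

end

theorem lemma3p3 (V : SchrodingerPoisson.Plane → ℝ)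
    (hV : SchrodingerPoisson.PotentialAssumption V) (p : ℝ) (hp : 4 < p) (c : ℝ) (hc : 0 < c)
    (u : ℕ → SchrodingerPoisson.X hV)
    (hu : SchrodingerPoisson.IsCeramiSeq (SchrodingerPoisson.action hV p) c u) :
    (∃ C : ℝ, ∀ n, ‖u n‖ ≤ C) ∧
      ∃ (xbar : SchrodingerPoisson.Plane) (d : ℝ), 0 < d ∧
        ∃ k : ℕ → ℕ, StrictMono k ∧
          ∀ n, d ≤ ∫ x in Metric.ball xbar 2, SchrodingerPoisson.X.fn (u (k n)) x ^ 2 := by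
  exact ⟨hu.exists_norm_le hp hc, hu.exists_ball hp hc⟩
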